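/- **Setting.** Let $\mathfrak C$ be a monster model of a complete first-order theory in a (one-sorted) language $L$ with infinite models: $\mathfrak C$ is infinite, $\kappa$-saturated and strongly $\kappa$-homogeneous for an uncountable strong limit cardinal $\kappa>|L|$. "Small" (or "bounded") means of cardinality less than $\kappa$. For a small index set $I$, a subset of $\mathfrak C^I$ is *type-definable* if it is the intersection of a small family of sets that are all definable over one small set of parameters; subsets of $Y\subseteq \mathfrak C^I$ and relations on $Y$ are type-definable if they are so as subsets of $\mathfrak C^I$ and $\mathfrak C^I\times\mathfrak C^I$. Let $G$ be a type-definable group (the set $G\subseteq\mathfrak C^J$ and the graph of its operation are type-definable, $J$ small) acting on a type-definable set $X\subseteq\mathfrak C^I$ ($I$ small) by an action with type-definable graph. For small $A\subseteq\mathfrak C$, let $G^{000}_A$ be the smallest subgroup of $G$ that has small index and is invariant over $A$, i.e. setwise invariant under all automorphisms of $\mathfrak C$ fixing $A$ pointwise (it is taken as the intersection of all such subgroups). For $H\le G$ and $\tilde X\subseteq X$ let $R_{H,\tilde X}$ be the relation on $X$ given by $$x_1\mathrel{R_{H,\tilde X}}x_2\iff \exists g\in G\ \exists h\in H\quad gx_1=hgx_2\in\tilde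 X .$$ An equivalence relation $E$ on $X$ is *weakly orbital* if $E=R_{H,\tilde X}$ for some $H\le G$ and $\tilde X\subseteq X$, and *weakly orbital by type-definable* if in addition $\tilde X$ can be chosen type-definable (with $H\leq G$ arbitrary). A subgroup $H\le G$ is a *maximal witness* for weak orbitality of $E$ if there is $\tilde X\subseteq X$ with $E=R_{H,\tilde X}$ and $E\ne R_{H',\tilde X}$ for all $H'\gneq H$; a set $\tilde X\subseteq X$ is a *maximal witness* if there is $H\le G$ with $E=R_{H,\tilde X}$ and $E\neq R_{H,\tilde X'}$ for all $\tilde X'\supsetneq\tilde X$. **Theorem.** Let $E$ be a $G$-invariant, weakly orbital equivalence relation on $X$ whose classes are $G^{000}_A$-invariant for some small set $A$. Then the following are equivalent: 1. $E$ is type-definable; 2. each $E$-class is type-definable and $E$ is weakly orbital by type-definable; 3. $E=R_{H,\tilde X}$ for some type-definable subgroup $H\le G$ and some type-definable $\tilde X\subseteq X$; 4. every subgroup $H\le G$ that is a maximal witness for weak orbitality of $E$ is type-definable, and every set $\tilde X\subseteq X$ that is a maximal witness for weak orbitality of $E$ is type-definable. Moreover, $E$ is bounded (i.e. $X/E$ is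 small) if and only if $X/G$ is small; and if $E$ is bounded, then the sets $C\subseteq X/E$ with type-definable preimage in $X$ are the closed sets of a topology on $X/E$ (the logic topology), and conditions 1–4 are equivalent to $X/E$ being Hausdorff in this topology. -/

import Mathlib

open Cardinal
open scoped FirstOrder

universe u v w

/-! ### Monster models, type-definable sets, invariant sets -/

section ModelTheory

variable (L : FirstOrder.Language.{u, v}) {M : Type w} [L.Structure M]

/-- `M` is `κ`-saturated: every set of formulas in one variable with parameters from a set of
size `< κ` which is finitely satisfiable in `M` is realised in `M`. -/
def IsSaturatedModel (κ : Cardinal.{w}) (M : Type w) [L.Structure M] : Prop :=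
  ∀ A : Set M, #A < κ → ∀ p : Set (L[[A]].Formula Unit),
    (∀ q : Finset (L[[A]].Formula Unit), (q : Set (L[[A]].Formula Unit)) ⊆ p →
      ∃ m : M, ∀ φ ∈ q, φ.Realize (fun _ => m)) →
    ∃ m : M, ∀ φ ∈ p, φ.Realize (fun _ => m)

/-- `M` is strongly `κ`-homogeneous: every elementary map defined on a subset of size `< κ`
extends to an automorphism of `M`. -/
def IsStronglyHomogeneousModel (κ : Cardinal.{w}) (M : Type w) [L.Structure M] : Prop :=
  ∀ A : Set M, #A < κ → ∀ f : A → M,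
    (∀ φ : L.Formula A, φ.Realize (fun a : A => (a : M)) ↔ φ.Realize f) →
    ∃ σ : M ≃[L] M, ∀ a : A, σ a = f a

/-- `M` is a monster model (of its complete theory) with respect to the cardinal `κ`;
"small" means "of cardinality `< κ`". -/
structure IsMonsterModel (κ : Cardinal.{w}) (M : Type w) [L.Structure M] : Prop where
  infinite : Infinite M
  strongLimit : κ.IsStrongLimit
  uncountable : ℵ₀ < κ
  language_small : Cardinal.lift.{w} L.card < Cardinal.lift.{max u v} κ
  saturated : IsSaturatedModel L κ M
  homogeneous : IsStronglyHomogeneousModel L κ M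

/-- `S` is type-definable over `A`: an intersection of a small family of sets that are definable
with parameters from `A`. -/
def IsTypeDefinableOver (κ : Cardinal.{w}) {α : Type w} (A : Set M) (S : Set (α → M)) : Prop :=
  ∃ F : Set (Set (α → M)), #F < κ ∧ (∀ D ∈ F, A.Definable L D) ∧ S = ⋂₀ F

/-- `S` is type-definable: type-definable over some small set of parameters. -/
def IsTypeDefinable (κ : Cardinal.{w}) {α : Type w} (S : Set (α → M)) : Prop :=
  ∃ A : Set M, #A < κ ∧ IsTypeDefinableOver L κ A S

/-- `S` is setwise invariant under the automorphisms of `M` that fix `A` pointwise. -/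
def IsInvariantOver {α : Type w} (A : Set M) (S : Set (α → M)) : Prop :=
  ∀ σ : M ≃[L] M, (∀ a ∈ A, σ a = a) → ∀ v : α → M, (fun i => σ (v i)) ∈ S ↔ v ∈ S

variable {I J : Type w} (G : Set (J → M)) (X : Set (I → M))

/-- `G` is a type-definable group (the set and the graph of its operation are type-definable)
acting on the type-definable set `X` by an action with a type-definable graph. -/
structure IsTypeDefinableAction (κ : Cardinal.{w}) [Group G] [MulAction G X] : Prop where
  group : IsTypeDefinable L κ G
  mul_graph : IsTypeDefinable L κ
    {v : J ⊕ J ⊕ J → M | ∃ a b : G, v = Sum.elim a.1 (Sum.elim b.1 (a * b).1)}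
  space : IsTypeDefinable L κ X
  smul_graph : IsTypeDefinable L κ
    {v : J ⊕ I ⊕ I → M | ∃ (g : G) (x : X), v = Sum.elim g.1 (Sum.elim x.1 (g • x).1)}

variable {G X}

/-- A subset of a subset `Y` of `M ^ α`, seen as a subset of `M ^ α`, is type-definable. -/
def IsTypeDefinableSubset (κ : Cardinal.{w}) {α : Type w} {Y : Set (α → M)} (S : Set Y) : Prop :=
  IsTypeDefinable L κ ((fun y : Y => (y : α → M)) '' S)

/-- A relation on `X`, seen as a subset of `M ^ I × M ^ I`, is type-definable. -/
def IsTypeDefinableRel (κ : Cardinal.{w}) (R : X → X → Prop) : Prop :=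
  IsTypeDefinable L κ {v : I ⊕ I → M | ∃ x y : X, R x y ∧ v = Sum.elim x.1 y.1}

variable (G) in
/-- The connected component `G⁰⁰⁰_A`: the intersection of all subgroups of small index in `G`
that are invariant over `A` (the smallest such subgroup). -/
def connectedComponent000 (κ : Cardinal.{w}) [Group G] (A : Set M) : Subgroup G :=
  sInf {H : Subgroup G |
    IsInvariantOver L A ((fun g : G => (g : J → M)) '' (H : Set G)) ∧ #(G ⧸ H) < κ}

/-- `τ` is the logic topology on `X / E`: a set is closed exactly when its preimage in `X` is
type-definable. -/
def IsLogicTopology (κ : Cardinal.{w}) (E : Setoid X) (τ : TopologicalSpace (Quotient E)) : Prop :=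
  ∀ C : Set (Quotient E),
    @IsClosed _ τ C ↔ IsTypeDefinableSubset L κ ((Quotient.mk E) ⁻¹' C)

end ModelTheory

/-! ### Weakly orbital equivalence relations -/

section WeaklyOrbital

variable {G : Type*} {X : Type*} [Group G] [MulAction G X]

/-- The relation `R_{H, Xt}`. -/
def orbitalRel (H : Subgroup G) (Xt : Set X) (x₁ x₂ : X) : Prop :=
  ∃ g : G, ∃ h ∈ H, g • x₁ = h • g • x₂ ∧ g • x₁ ∈ Xt

/-- `E = R_{H, Xt}`. -/
def IsWitnessPair (E : Setoid X) (H : Subgroup G) (Xt : Set X) : Prop :=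
  ∀ x₁ x₂ : X, E x₁ x₂ ↔ orbitalRel H Xt x₁ x₂

variable (G) in
/-- `E` is `G`-invariant. -/
def IsInvariantSetoid (E : Setoid X) : Prop :=
  ∀ (g : G) (x₁ x₂ : X), E x₁ x₂ ↔ E (g • x₁) (g • x₂)

variable (G) in
/-- `E` is weakly orbital. -/
def IsWeaklyOrbital (E : Setoid X) : Prop :=
  ∃ (H : Subgroup G) (Xt : Set X), IsWitnessPair E H Xt

/-- The subgroup `H` is a maximal witness for weak orbitality of `E`. -/
def IsMaximalWitnessSubgroup (E : Setoid X) (H : Subgroup G) : Prop :=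
  ∃ Xt : Set X, IsWitnessPair E H Xt ∧ ∀ H' : Subgroup G, H < H' → ¬ IsWitnessPair E H' Xt

variable (G) in
/-- The set `Xt` is a maximal witness for weak orbitality of `E`. -/
def IsMaximalWitnessSet (E : Setoid X) (Xt : Set X) : Prop :=
  ∃ H : Subgroup G, IsWitnessPair E H Xt ∧ ∀ Xt' : Set X, Xt ⊂ Xt' → ¬ IsWitnessPair E H Xt'

end WeaklyOrbital

/-! ### Definable sets of possibly infinite tuples, and equality of types -/

section DefinableSets

open FirstOrder FirstOrder.Language

variable {L : FirstOrder.Language.{u, v}} {M : Type w} [L.Structure M]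

/-! If `E = R_{H,Xt}`, then every element of `H` preserves the class of every point of `Xt`;
conversely, any pair that enlarges a witness pair and still has this property is again a witness
pair (`IsWitnessPair.enlarge`). Maximal witnesses are therefore the closed members of a Galois
connection: `H` is a `classwiseStabilizer`, respectively `Xt` is a set of `stablePoints`. Both are
intersections of conditions `E x (g • x)`, one for each `x` or each `g`, and there may be too many
of them for type-definability to be clear.

The connected component resolves this. It has small index, so some small `C` contains
representatives of all its cosets. Since it preserves all classes, `E x (g • x)` depends on `g` only
modulo the component. As a condition on `g` it is then invariant over `C`; as a condition on `x` it
can be written with a representative from `C` in place of `g`. The parameters thus no longer depend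
on the index, and arbitrary intersections of sets type-definable over one small set are
type-definable. This gives 1 → 4 and 2 → 3, while 3 → 1 is compactness: projections of
type-definable sets are type-definable (`IsTypeClosed.exists_sum`).

Small index holds because elements of `G` with the same type over a suitable small model lie in the
same coset of every invariant subgroup of small index (`exists_small_sameType_imp_eq`), and there
are few types as `κ` is a strong limit.

For bounded `E`, automorphisms fixing `C` and a representative of each class preserve every class.
Hence all type-definable saturated sets are type-definable over one small set; this yields the
topology, and reduces the Hausdorff property to separation of disjoint type-definable sets by
definable ones. -/

theorem Set.Definable.exists_finite_support {α : Type*} {B : Set M} {D : Set (α → M)}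
    (h : B.Definable L D) :
    ∃ (t : Finset α) (D₀ : Set (t → M)), B.Definable L D₀ ∧
      ∀ v, v ∈ D ↔ (fun i : t => v i) ∈ D₀ := by
  classical
  obtain ⟨φ, rfl⟩ := h
  refine ⟨φ.freeVarFinset, _, ⟨φ.restrictFreeVar id, rfl⟩, fun v => ?_⟩
  simp only [Set.mem_ofPred_eq, Formula.Realize]
  exact (BoundedFormula.realize_restrictFreeVar v (by simp)).symm

/-- A definable set constrains finitely many coordinates only, so quantifying over an infinite tuple
reduces to finitely many quantifiers; the other coordinates get an arbitrary value. -/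
theorem Set.Definable.exists_sum [Nonempty M] {α β : Type*} {B : Set M} {D : Set (α ⊕ β → M)}
    (h : B.Definable L D) : B.Definable L {v : α → M | ∃ w : β → M, Sum.elim v w ∈ D} := by
  classical
  obtain ⟨t, D₀, hD₀, hD⟩ := h.exists_finite_support
  let f : t → α ⊕ t.toRight := fun x =>
    match x with
    | ⟨.inl a, _⟩ => .inl a
    | ⟨.inr b, hb⟩ => .inr ⟨b, by simpa using hb⟩
  have h1 := (hD₀.preimage_comp f).exists_of_finite
  convert h1 using 1
  ext v
  simp only [Set.mem_ofPred_eq, Set.mem_preimage, hD]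
  constructor
  · rintro ⟨w, hw⟩
    refine ⟨fun b => w b, ?_⟩
    convert hw using 1
    ext ⟨x, hx⟩
    cases x <;> rfl
  · rintro ⟨w, hw⟩
    refine ⟨fun b => if hb : b ∈ t.toRight then w ⟨b, hb⟩ else Classical.arbitrary M, ?_⟩
    convert hw using 1
    ext ⟨x, hx⟩
    cases x with
    | inl a => rfl
    | inr b =>
      have hb : b ∈ t.toRight := by simpa using hx
      simp [f, hx]

theorem Set.Definable.comp_mem_iff {α : Type*} {B : Set M} {D : Set (α → M)}
    (h : B.Definable L D) (σ : M ≃[L] M) (hσ : ∀ b ∈ B, σ b = b) (v : α → M) :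
    (fun i => σ (v i)) ∈ D ↔ v ∈ D := by
  obtain ⟨φ, rfl⟩ := Set.definable_iff_exists_formula_sum.1 h
  simp only [Set.mem_ofPred_eq]
  rw [← StrongHomClass.realize_formula σ φ (v := Sum.elim (↑) v)]
  have : (σ ∘ Sum.elim (fun b : B => (b : M)) v) = Sum.elim (fun b : B => (b : M))
      (fun i => σ (v i)) := by
    ext x
    cases x with
    | inl b => exact hσ b.1 b.2
    | inr i => rfl
  rw [this]

theorem Set.Definable.fiber {α β : Type*} {B : Set M} {D : Set (α ⊕ β → M)}
    (h : B.Definable L D) (a : α → M) :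
    (B ∪ Set.range a).Definable L {w : β → M | Sum.elim a w ∈ D} := by
  obtain ⟨φ, rfl⟩ := Set.definable_iff_exists_formula_sum.1 h
  rw [Set.definable_iff_exists_formula_sum]
  refine ⟨φ.relabel (Sum.elim (fun b : B => .inl ⟨b.1, .inl b.2⟩)
    (Sum.elim (fun i => .inl ⟨a i, .inr ⟨i, rfl⟩⟩) .inr)), ?_⟩
  ext w
  simp only [Set.mem_ofPred_eq, Formula.realize_relabel]
  refine iff_of_eq (congrArg _ ?_)
  ext x
  rcases x with b | i | j <;> rfl

theorem Set.Definable.coord_eq {α : Type*} (B : Set M) (i j : α) :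
    B.Definable L {v : α → M | v i = v j} :=
  ⟨(Term.var i).equal (Term.var j), by ext; simp⟩

/-- Two tuples have the same type over `B`. -/
def SameType (L : FirstOrder.Language.{u, v}) {M : Type w} [L.Structure M] {α : Type*}
    (B : Set M) (a b : α → M) : Prop :=
  ∀ D : Set (α → M), B.Definable L D → (a ∈ D ↔ b ∈ D)

theorem SameType.of_imp {α : Type*} {B : Set M} {a b : α → M}
    (h : ∀ D : Set (α → M), B.Definable L D → a ∈ D → b ∈ D) : SameType L B a b :=
  fun D hD => ⟨h D hD, fun hb => by_contra fun ha => h _ hD.compl ha hb⟩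

/-- Homogeneity concerns maps on subsets, while a tuple may repeat entries; equality formulas show
that `b` repeats wherever `a` does. -/
theorem IsStronglyHomogeneousModel.exists_comp_eq {κ : Cardinal.{w}}
    (hM : IsStronglyHomogeneousModel L κ M) {γ : Type w} (hγ : #γ < κ) {a b : γ → M}
    (h : ∀ φ : L.Formula γ, φ.Realize a ↔ φ.Realize b) :
    ∃ σ : M ≃[L] M, ∀ i, σ (a i) = b i := by
  choose s hs using fun m : Set.range a => m.2
  obtain ⟨σ, hσ⟩ := hM (Set.range a) (mk_range_le.trans_lt hγ) (fun m => b (s m)) (fun φ => by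
    have := h (φ.relabel s)
    simp only [Formula.realize_relabel] at this
    rw [show a ∘ s = fun m : Set.range a => (m : M) from funext hs] at this
    exact this)
  refine ⟨σ, fun i => ?_⟩
  rw [hσ ⟨a i, i, rfl⟩]
  have := h ((Term.var (s ⟨a i, i, rfl⟩)).equal (Term.var i))
  simp only [Formula.realize_equal, Term.realize_var] at this
  exact this.1 (hs ⟨a i, i, rfl⟩)

theorem IsMonsterModel.add_lt {κ : Cardinal.{w}} (hM : IsMonsterModel L κ M) {a b : Cardinal.{w}}
    (ha : a < κ) (hb : b < κ) : a + b < κ :=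
  Cardinal.add_lt_of_lt hM.uncountable.le ha hb

theorem IsMonsterModel.mk_union_lt {κ : Cardinal.{w}} (hM : IsMonsterModel L κ M) {α : Type w}
    {A B : Set α} (hA : #A < κ) (hB : #B < κ) : #(A ∪ B : Set α) < κ :=
  (Cardinal.mk_union_le A B).trans_lt (hM.add_lt hA hB)

theorem IsMonsterModel.mk_sum_lt {κ : Cardinal.{w}} (hM : IsMonsterModel L κ M) {α β : Type w}
    (hα : #α < κ) (hβ : #β < κ) : #(α ⊕ β) < κ := by
  rw [Cardinal.mk_sum, Cardinal.lift_id, Cardinal.lift_id]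
  exact hM.add_lt hα hβ

theorem SameType.exists_automorphism {κ : Cardinal.{w}} (hM : IsMonsterModel L κ M) {α : Type w}
    (hα : #α < κ) {B : Set M} (hB : #B < κ) {a b : α → M} (h : SameType L B a b) :
    ∃ σ : M ≃[L] M, (∀ m ∈ B, σ m = m) ∧ ∀ i, σ (a i) = b i := by
  obtain ⟨σ, hσ⟩ := hM.homogeneous.exists_comp_eq (γ := B ⊕ α) (hM.mk_sum_lt hB hα)
    (a := Sum.elim (fun m : B => (m : M)) a) (b := Sum.elim (fun m : B => (m : M)) b)
    (fun φ => h {v | φ.Realize (Sum.elim (fun m : B => (m : M)) v)}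
      (Set.definable_iff_exists_formula_sum.2 ⟨φ, rfl⟩))
  exact ⟨σ, fun m hm => hσ (.inl ⟨m, hm⟩), fun i => hσ (.inr i)⟩

theorem IsMonsterModel.mk_definable_lt {κ : Cardinal.{w}} (hM : IsMonsterModel L κ M)
    {α : Type w} (hα : #α < κ) {B : Set M} (hB : #B < κ) :
    #{D : Set (α → M) | B.Definable L D} < κ := by
  let f : L.Formula (B ⊕ α) → {D : Set (α → M) | B.Definable L D} := fun φ =>
    ⟨{v | φ.Realize (Sum.elim (↑) v)}, Set.definable_iff_exists_formula_sum.2 ⟨φ, rfl⟩⟩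
  have hf : Function.Surjective f := by
    rintro ⟨D, hD⟩
    obtain ⟨φ, rfl⟩ := Set.definable_iff_exists_formula_sum.1 hD
    exact ⟨φ, rfl⟩
  have h1 := Cardinal.mk_le_of_surjective (f := fun x : ULift.{max u v} (L.Formula (B ⊕ α)) =>
    (ULift.up.{max u v} (f x.down))) (by
      rintro ⟨y⟩
      obtain ⟨φ, hφ⟩ := hf y
      exact ⟨⟨φ⟩, by simp [hφ]⟩)
  simp only [mk_uLift] at h1
  rw [← Cardinal.lift_lt.{w, max u v}]
  refine h1.trans_lt ?_
  have h2 : #(L.Formula (B ⊕ α)) ≤ #(Σ n, L.BoundedFormula (B ⊕ α) n) :=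
    Cardinal.mk_le_of_injective (f := fun φ => ⟨0, φ⟩) (by
      intro x y hxy
      simpa using hxy)
  have h3 := h2.trans BoundedFormula.card_le
  have h4 : #(L.Formula (B ⊕ α)) < Cardinal.lift.{max u v} κ := by
    refine h3.trans_lt (max_lt ?_ (Cardinal.add_lt_of_lt ?_ ?_ ?_))
    · simpa using hM.uncountable
    · simpa using hM.uncountable.le
    · exact Cardinal.lift_lt.2 (hM.mk_sum_lt hB hα)
    · exact hM.language_small
  have h5 := (Cardinal.lift_id'.{max u v, w} #(L.Formula (B ⊕ α))).trans_lt h4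
  simpa using h5

theorem IsMonsterModel.exists_mem_of_definable₁ {κ : Cardinal.{w}} (hM : IsMonsterModel L κ M)
    {B : Set M} (hB : #B < κ) (F : Set (Set M))
    (hF : ∀ S ∈ F, B.Definable L {v : Unit → M | v () ∈ S})
    (hfin : ∀ q : Finset (Set M), (q : Set (Set M)) ⊆ F → ∃ m, ∀ S ∈ q, m ∈ S) :
    ∃ m, ∀ S ∈ F, m ∈ S := by
  classical
  obtain ⟨m, hm⟩ := hM.saturated B hB
    {φ | ∃ S ∈ F, ∀ m : M, φ.Realize (fun _ : Unit => m) ↔ m ∈ S} (fun q hq => by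
      choose! s hs using hq
      obtain ⟨m, hm⟩ := hfin (q.image s) (by
        intro S hS
        obtain ⟨φ, hφ, rfl⟩ := Finset.mem_image.1 (Finset.mem_coe.1 hS)
        exact (hs hφ).1)
      exact ⟨m, fun φ hφ => ((hs hφ).2 m).2 (hm _ (Finset.mem_image_of_mem _ hφ))⟩)
  refine ⟨m, fun S hS => ?_⟩
  obtain ⟨φ, hφ⟩ := hF S hS
  have key : ∀ m : M, φ.Realize (fun _ : Unit => m) ↔ m ∈ S := fun m => by
    have : (fun _ : Unit => m) ∈ {v : Unit → M | v () ∈ S} ↔ φ.Realize (fun _ : Unit => m) := by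
      rw [hφ]; rfl
    exact this.symm
  exact (key m).1 (hm φ ⟨S, hS, key⟩)

end DefinableSets

/-! ### Compactness, and type-definability as closedness -/

section TypeClosed

open FirstOrder FirstOrder.Language

variable {L : FirstOrder.Language.{u, v}} {M : Type w} [L.Structure M]

theorem Set.Definable.coord_eq_const {α : Type*} {B : Set M} {c : M} (hc : c ∈ B) (i : α) :
    B.Definable L {v : α → M | v i = c} := by
  rw [Set.definable_iff_exists_formula_sum]
  exact ⟨(Term.var (.inr i)).equal (Term.var (.inl ⟨c, hc⟩)), by ext; simp⟩

theorem Set.Definable.section₁ [Nonempty M] {α : Type*} {B : Set M} {D : Set (α → M)}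
    (hD : B.Definable L D) (q : Finset (α × M)) (hq : ∀ p ∈ q, p.2 ∈ B) (i : α) :
    B.Definable L {u : Unit → M |
      u () ∈ {m | ∃ v ∈ D, (∀ p ∈ q, v p.1 = p.2) ∧ v i = m}} := by
  have h1 : B.Definable L ({v : Unit ⊕ α → M | v ∘ Sum.inr ∈ D} ∩
      (⋂ p : q, {v : Unit ⊕ α → M | v (.inr p.1.1) = p.1.2}) ∩
      {v : Unit ⊕ α → M | v (.inr i) = v (.inl ())}) :=
    ((hD.preimage_comp Sum.inr).inter (Set.definable_iInter_of_finite
      fun p : q => .coord_eq_const (hq p.1 p.2) _)).inter (.coord_eq _ _ _)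
  convert h1.exists_sum using 1
  ext u
  simp only [Set.mem_ofPred_eq, Set.mem_inter_iff, Set.mem_iInter, Sum.elim_inr, Sum.elim_inl,
    Sum.elim_comp_inr, Subtype.forall, and_assoc]

/-- Compactness of a monster model for small tuples of variables. -/
theorem IsMonsterModel.exists_mem_of_definable {κ : Cardinal.{w}} (hM : IsMonsterModel L κ M)
    {α : Type w} (hα : #α < κ) {B : Set M} (hB : #B < κ) (F : Set (Set (α → M)))
    (hF : ∀ D ∈ F, B.Definable L D) (huniv : Set.univ ∈ F)
    (hinter : ∀ D ∈ F, ∀ D' ∈ F, D ∩ D' ∈ F) (hne : ∀ D ∈ F, D.Nonempty) :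
    ∃ v, ∀ D ∈ F, v ∈ D := by
  classical
  have := hM.infinite
  -- `T` is a partial assignment of values to coordinates, and `P T` says that each finite part of
  -- it extends to a point of each member of `F`. A maximal such `T` is the graph of the desired
  -- tuple.
  let P : Set (α × M) → Prop := fun T =>
    ∀ D ∈ F, ∀ q : Finset (α × M), (q : Set (α × M)) ⊆ T → ∃ v ∈ D, ∀ p ∈ q, v p.1 = p.2
  obtain ⟨T, hT⟩ : ∃ T, Maximal (· ∈ {T | P T}) T := by
    refine zorn_subset _ fun c hc hchain => ?_
    rcases c.eq_empty_or_nonempty with rfl | hcne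
    · refine ⟨∅, fun D hD q hq => ?_, by simp⟩
      obtain ⟨v, hv⟩ := hne D hD
      exact ⟨v, hv, fun p hp => absurd (hq hp) (by simp)⟩
    · refine ⟨⋃₀ c, fun D hD q hq => ?_, fun s hs => Set.subset_sUnion_of_mem hs⟩
      obtain ⟨s, hs, hqs⟩ := hchain.directedOn.exists_mem_subset_of_finset_subset_biUnion
        (f := id) hcne (s := q) (by simpa [Set.sUnion_eq_biUnion] using hq)
      exact hc hs D hD q hqs
  have hPT : P T := hT.prop
  have hfun : ∀ i m m', (i, m) ∈ T → (i, m') ∈ T → m = m' := by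
    intro i m m' h h'
    obtain ⟨v, -, hv⟩ := hPT _ huniv {(i, m), (i, m')} (by
      intro p hp
      simp only [Finset.coe_insert, Finset.coe_singleton, Set.mem_insert_iff,
        Set.mem_singleton_iff] at hp
      rcases hp with rfl | rfl <;> assumption)
    exact (hv (i, m) (by simp)).symm.trans (hv (i, m') (by simp))
  have hcard : #(Prod.snd '' T) < κ := by
    refine mk_image_le.trans_lt (lt_of_le_of_lt ?_ hα)
    refine Cardinal.mk_le_of_injective (f := fun p : T => p.1.1) ?_
    rintro ⟨⟨i, m⟩, h⟩ ⟨⟨i', m'⟩, h'⟩ (rfl : i = i')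
    simp [hfun i m m' h h']
  have htotal : ∀ i, ∃ m, (i, m) ∈ T := by
    intro i
    -- The values at `i` allowed by `D` and a finite part `q` of `T`; one-variable saturation finds
    -- a value allowed by all of them.
    let S : Set (α → M) → Finset (α × M) → Set M := fun D q =>
      {m | ∃ v ∈ D, (∀ p ∈ q, v p.1 = p.2) ∧ v i = m}
    obtain ⟨m, hm⟩ := hM.exists_mem_of_definable₁ (hM.mk_union_lt hB hcard)
      {s | ∃ D ∈ F, ∃ q : Finset (α × M), (q : Set (α × M)) ⊆ T ∧ s = S D q} (by
        rintro _ ⟨D, hD, q, hq, rfl⟩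
        exact ((hF D hD).mono Set.subset_union_left).section₁ q
          (fun p hp => Or.inr (Set.mem_image_of_mem _ (hq hp))) i) (by
        intro Q hQ
        have : ∃ D ∈ F, ∃ q : Finset (α × M), (q : Set (α × M)) ⊆ T ∧ ∀ s ∈ Q, S D q ⊆ s := by
          induction Q using Finset.induction_on with
          | empty => exact ⟨_, huniv, ∅, by simp, by simp⟩
          | insert s Q _ ih =>
            obtain ⟨D, hD, q, hq, h⟩ := ih fun s hs => hQ (by simp [Finset.mem_coe.1 hs])
            obtain ⟨D', hD', q', hq', rfl⟩ := hQ (Finset.mem_coe.2 (Finset.mem_insert_self s Q))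
            refine ⟨D ∩ D', hinter _ hD _ hD', q ∪ q', by simp [hq, hq'], fun s hs => ?_⟩
            rcases Finset.mem_insert.1 hs with rfl | hs
            · rintro m ⟨v, hv, hvq, hvi⟩
              exact ⟨v, hv.2, fun p hp => hvq p (Finset.mem_union_right _ hp), hvi⟩
            · rintro m ⟨v, hv, hvq, hvi⟩
              exact h s hs ⟨v, hv.1, fun p hp => hvq p (Finset.mem_union_left _ hp), hvi⟩
        obtain ⟨D, hD, q, hq, h⟩ := this
        obtain ⟨v, hv, hvq⟩ := hPT D hD q hq
        exact ⟨v i, fun s hs => h s hs ⟨v, hv, hvq, rfl⟩⟩)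
    refine ⟨m, hT.le_of_ge (y := insert (i, m) T) (fun D hD q hq => ?_) (Set.subset_insert _ _)
      (Set.mem_insert _ _)⟩
    obtain ⟨v, hv, hvq, hvi⟩ := hm _ ⟨D, hD, q.erase (i, m), fun p hp => by
      have hp' := Finset.mem_erase.1 (Finset.mem_coe.1 hp)
      exact (hq hp'.2).resolve_left hp'.1, rfl⟩
    refine ⟨v, hv, fun p hp => ?_⟩
    by_cases hpi : p = (i, m)
    · rw [hpi]; exact hvi
    · exact hvq p (Finset.mem_erase.2 ⟨hpi, hp⟩)
  choose a ha using htotal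
  refine ⟨a, fun D hD => ?_⟩
  obtain ⟨t, D₀, -, hD₀⟩ := (hF D hD).exists_finite_support
  obtain ⟨v, hv, hvt⟩ := hPT D hD (t.image fun i => (i, a i)) (by
    intro p hp
    obtain ⟨i, -, rfl⟩ := Finset.mem_image.1 (Finset.mem_coe.1 hp)
    exact ha i)
  rw [hD₀] at hv ⊢
  convert hv using 1
  ext i
  exact (hvt (i, a i) (Finset.mem_image_of_mem _ i.2)).symm

/-- `S` is closed in the topology generated by the `B`-definable sets. -/
def IsTypeClosed (L : FirstOrder.Language.{u, v}) {M : Type w} [L.Structure M] {α : Type*}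
    (B : Set M) (S : Set (α → M)) : Prop :=
  ∀ v, (∀ D, B.Definable L D → S ⊆ D → v ∈ D) → v ∈ S

namespace IsTypeClosed

variable {α β : Type*} {B C : Set M} {S T : Set (α → M)}

theorem mono (h : IsTypeClosed L B S) (hBC : B ⊆ C) : IsTypeClosed L C S :=
  fun v hv => h v fun D hD => hv D (hD.mono hBC)

theorem of_definable (h : B.Definable L S) : IsTypeClosed L B S :=
  fun _ hv => hv S h subset_rfl

theorem iInter {ι : Sort*} {S : ι → Set (α → M)} (h : ∀ i, IsTypeClosed L B (S i)) :
    IsTypeClosed L B (⋂ i, S i) :=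
  fun v hv => Set.mem_iInter.2 fun i => h i v fun D hD hSD =>
    hv D hD ((Set.iInter_subset S i).trans hSD)

theorem sInter {F : Set (Set (α → M))} (h : ∀ S ∈ F, IsTypeClosed L B S) :
    IsTypeClosed L B (⋂₀ F) := by
  rw [Set.sInter_eq_iInter]
  exact iInter fun S => h S S.2

theorem inter (hS : IsTypeClosed L B S) (hT : IsTypeClosed L B T) :
    IsTypeClosed L B (S ∩ T) :=
  fun v hv => ⟨hS v fun D hD hSD => hv D hD (Set.inter_subset_left.trans hSD),
    hT v fun D hD hSD => hv D hD (Set.inter_subset_right.trans hSD)⟩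

theorem union (hS : IsTypeClosed L B S) (hT : IsTypeClosed L B T) :
    IsTypeClosed L B (S ∪ T) := by
  intro v hv
  by_contra hvn
  simp only [Set.mem_union, not_or] at hvn
  have h1 := mt (hS v) hvn.1
  have h2 := mt (hT v) hvn.2
  push Not at h1 h2
  obtain ⟨D, hD, hSD, hvD⟩ := h1
  obtain ⟨D', hD', hTD, hvD'⟩ := h2
  exact (hv _ (hD.union hD') (Set.union_subset_union hSD hTD)).elim hvD hvD'

theorem preimage_comp (h : IsTypeClosed L B S) (f : α → β) :
    IsTypeClosed L B {v : β → M | v ∘ f ∈ S} :=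
  fun _ hv => h _ fun _ hD hSD => hv _ (hD.preimage_comp f) fun _ hu => hSD hu

theorem fiber {S : Set (α ⊕ β → M)} (h : IsTypeClosed L B S) (a : α → M) :
    IsTypeClosed L (B ∪ Set.range a) {w : β → M | Sum.elim a w ∈ S} :=
  fun _ hv => h _ fun _ hD hSD => hv _ (hD.fiber a) fun _ hu => hSD hu

end IsTypeClosed

section Monster

variable {κ : Cardinal.{w}} {α β : Type w} {B C : Set M}

/-- There are few `B`-definable sets altogether, so the bound on the size of the defining family is
automatic. What remains is closedness, which is stable under intersections of any size. -/
theorem isTypeDefinableOver_iff (hM : IsMonsterModel L κ M) (hα : #α < κ) (hB : #B < κ)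
    {S : Set (α → M)} : IsTypeDefinableOver L κ B S ↔ IsTypeClosed L B S := by
  constructor
  · rintro ⟨F, -, hF, rfl⟩
    exact .sInter fun D hD => .of_definable (hF D hD)
  · intro h
    refine ⟨{D | B.Definable L D ∧ S ⊆ D}, ?_, fun D hD => hD.1, ?_⟩
    · exact (Cardinal.mk_le_mk_of_subset fun D hD => hD.1).trans_lt (hM.mk_definable_lt hα hB)
    · exact Set.Subset.antisymm (fun v hv D hD => hD.2 hv) fun v hv => h v fun D hD hSD =>
        hv D ⟨hD, hSD⟩

theorem isTypeDefinable_iff (hM : IsMonsterModel L κ M) (hα : #α < κ) {S : Set (α → M)} :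
    IsTypeDefinable L κ S ↔ ∃ B : Set M, #B < κ ∧ IsTypeClosed L B S :=
  ⟨fun ⟨B, hB, h⟩ => ⟨B, hB, (isTypeDefinableOver_iff hM hα hB).1 h⟩,
    fun ⟨B, hB, h⟩ => ⟨B, hB, (isTypeDefinableOver_iff hM hα hB).2 h⟩⟩

theorem IsMonsterModel.mk_union_range_lt (hM : IsMonsterModel L κ M) (hB : #B < κ) (hα : #α < κ)
    (a : α → M) : #(B ∪ Set.range a : Set M) < κ :=
  hM.mk_union_lt hB (mk_range_le.trans_lt hα)

/-- If `v` lies in every definable set containing the projection, the fibres over `v` of the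
definable supersets of `S` have the finite intersection property; compactness supplies a common
point. -/
theorem IsTypeClosed.exists_sum (hM : IsMonsterModel L κ M) (hα : #α < κ) (hβ : #β < κ)
    (hB : #B < κ) {S : Set (α ⊕ β → M)} (h : IsTypeClosed L B S) :
    IsTypeClosed L B {v : α → M | ∃ w : β → M, Sum.elim v w ∈ S} := by
  have := hM.infinite
  intro v hv
  obtain ⟨w, hw⟩ := hM.exists_mem_of_definable hβ (hM.mk_union_range_lt hB hα v)
    {E | ∃ D, B.Definable L D ∧ S ⊆ D ∧ E = {w : β → M | Sum.elim v w ∈ D}}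
    (by rintro _ ⟨D, hD, -, rfl⟩; exact hD.fiber v)
    ⟨Set.univ, Set.definable_univ, Set.subset_univ _, by simp⟩
    (by
      rintro _ ⟨D, hD, hSD, rfl⟩ _ ⟨D', hD', hSD', rfl⟩
      exact ⟨D ∩ D', hD.inter hD', Set.subset_inter hSD hSD', rfl⟩)
    (by
      rintro _ ⟨D, hD, hSD, rfl⟩
      exact hv _ hD.exists_sum fun u ⟨w, hw⟩ => ⟨w, hSD hw⟩)
  exact ⟨w, h _ fun D hD hSD => hw _ ⟨D, hD, hSD, rfl⟩⟩

/-- A `B`-invariant type-definable set is type-definable over `B`. -/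
theorem IsTypeClosed.of_invariant (hM : IsMonsterModel L κ M) (hα : #α < κ) (hB : #B < κ)
    (hC : #C < κ) {S : Set (α → M)} (h : IsTypeClosed L C S) (hS : IsInvariantOver L B S) :
    IsTypeClosed L B S := by
  -- Compactness produces `u ∈ S` with the same type over `B` as `v`; an automorphism over `B`
  -- carries `v` to `u`, so invariance puts `v` in `S`.
  intro v hv
  obtain ⟨u, hu⟩ := hM.exists_mem_of_definable hα (hM.mk_union_lt hB hC)
    {E | ∃ D D', C.Definable L D ∧ S ⊆ D ∧ B.Definable L D' ∧ v ∈ D' ∧ E = D ∩ D'}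
    (by
      rintro _ ⟨D, D', hD, -, hD', -, rfl⟩
      exact (hD.mono Set.subset_union_right).inter (hD'.mono Set.subset_union_left))
    ⟨Set.univ, Set.univ, by simp⟩
    (by
      rintro _ ⟨D, D', hD, hSD, hD', hvD', rfl⟩ _ ⟨D₁, D₁', hD₁, hSD₁, hD₁', hvD₁', rfl⟩
      exact ⟨D ∩ D₁, D' ∩ D₁', hD.inter hD₁, Set.subset_inter hSD hSD₁, hD'.inter hD₁',
        ⟨hvD', hvD₁'⟩, Set.inter_inter_inter_comm _ _ _ _⟩)
    (by
      rintro _ ⟨D, D', hD, hSD, hD', hvD', rfl⟩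
      by_contra hne
      refine hv _ hD'.compl (fun x hx hx' => ?_) hvD'
      exact hne ⟨x, hSD hx, hx'⟩)
  have huS : u ∈ S := h u fun D hD hSD =>
    (hu _ ⟨D, Set.univ, hD, hSD, Set.definable_univ, trivial, rfl⟩).1
  have htype : SameType L B v u := .of_imp fun D hD hvD =>
    (hu _ ⟨Set.univ, D, Set.definable_univ, Set.subset_univ _, hD, hvD, rfl⟩).2
  obtain ⟨σ, hσ, hσv⟩ := htype.exists_automorphism hM hα hB
  rw [← hS σ hσ v]
  simpa only [hσv] using huS

end Monster

end TypeClosed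

/-! ### Invariant equivalence relations with few classes -/

section BoundedInvariant

open FirstOrder FirstOrder.Language

variable {L : FirstOrder.Language.{u, v}} {M : Type w} [L.Structure M] {κ : Cardinal.{w}}

/-- In a smaller model all elements could serve as parameters, and saturation would give an element
different from all of them. -/
theorem IsMonsterModel.le_mk (hM : IsMonsterModel L κ M) : κ ≤ #M := by
  classical
  have := hM.infinite
  by_contra! h
  obtain ⟨m, hm⟩ := hM.exists_mem_of_definable₁ (B := Set.univ) (by simpa using h)
    (Set.range fun m : M => ({m}ᶜ : Set M))
    (by
      rintro _ ⟨m, rfl⟩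
      exact (Set.Definable.coord_eq_const (Set.mem_univ m) ()).compl)
    (by
      intro q hq
      choose! s hs using hq
      obtain ⟨m, hm⟩ := Infinite.exists_notMem_finset (q.image s)
      refine ⟨m, fun S hS => ?_⟩
      rw [← hs (Finset.mem_coe.2 hS)]
      rintro rfl
      exact hm (Finset.mem_image_of_mem _ hS))
  exact hm _ ⟨m, rfl⟩ rfl

/-- The universe of an elementary substructure meets every nonempty definable set of tuples. -/
theorem FirstOrder.Language.ElementarySubstructure.exists_mem_of_definable [Nonempty M]
    (S : L.ElementarySubstructure M) {α : Type*} {D : Set (α → M)}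
    (hD : (S : Set M).Definable L D) (hne : D.Nonempty) : ∃ u ∈ D, ∀ i, u i ∈ (S : Set M) := by
  classical
  obtain ⟨t, D₀, hD₀, h⟩ := hD.exists_finite_support
  obtain ⟨φ, rfl⟩ := Set.definable_iff_exists_formula_sum.1 hD₀
  obtain ⟨v, hv⟩ := hne
  rw [h] at hv
  have h1 : (φ.iExs t).Realize (S.subtype ∘ fun x : (S : Set M) => (⟨x.1, x.2⟩ : S)) :=
    Formula.realize_iExs.2 ⟨fun i => v i, hv⟩
  rw [S.subtype.map_formula, Formula.realize_iExs] at h1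
  obtain ⟨w, hw⟩ := h1
  rw [← S.subtype.map_formula] at hw
  have : Nonempty S := inferInstance
  refine ⟨fun i => if hi : i ∈ t then (w ⟨i, hi⟩ : M) else (Classical.arbitrary S : S), ?_, ?_⟩
  · rw [h]
    simp only [Set.mem_ofPred_eq]
    convert hw using 1
    ext x
    rcases x with x | ⟨i, hi⟩
    · rfl
    · simp
  · intro i
    by_cases hi : i ∈ t
    · simp [hi]
    · simp [hi]

theorem IsMonsterModel.exists_small_elementarySubstructure (hM : IsMonsterModel L κ M)
    {B : Set M} (hB : #B < κ) :
    ∃ S : L.ElementarySubstructure M, B ⊆ (S : Set M) ∧ #(S : Set M) < κ := by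
  obtain ⟨c, hc, hcL⟩ := Cardinal.lt_lift_iff.1 hM.language_small
  have hlt : max (max ℵ₀ #B) c < κ := max_lt (max_lt hM.uncountable hB) hc
  obtain ⟨S, hBS, hS⟩ := exists_elementarySubstructure_card_eq L B (max (max ℵ₀ #B) c)
    (by simp) (by simp)
    (by rw [← hcL]; exact Cardinal.lift_le.2 (le_max_right _ _))
    (by simpa using hlt.le.trans hM.le_mk)
  refine ⟨S, hBS, ?_⟩
  rw [Cardinal.lift_inj] at hS
  exact hS.trans_lt hlt

/-- The tuple `c` realises the restriction to `C` of the average type of `U`. -/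
def RealizesAverage (L : FirstOrder.Language.{u, v}) {M : Type w} [L.Structure M] {α : Type*}
    (U : Ultrafilter (α → M)) (C : Set M) (c : α → M) : Prop :=
  ∀ D, C.Definable L D → D ∈ U → c ∈ D

theorem RealizesAverage.mono {α : Type*} {U : Ultrafilter (α → M)} {B C : Set M} {c : α → M}
    (h : RealizesAverage L U C c) (hBC : B ⊆ C) : RealizesAverage L U B c :=
  fun D hD => h D (hD.mono hBC)

theorem RealizesAverage.mem_iff {α : Type*} {U : Ultrafilter (α → M)} {C : Set M} {c : α → M}
    (h : RealizesAverage L U C c) {D : Set (α → M)} (hD : C.Definable L D) : c ∈ D ↔ D ∈ U :=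
  ⟨fun hc => by_contra fun hn => h _ hD.compl (Ultrafilter.compl_mem_iff_notMem.2 hn) hc, h D hD⟩

theorem exists_realizesAverage (hM : IsMonsterModel L κ M) {α : Type w} (hα : #α < κ)
    (U : Ultrafilter (α → M)) {C : Set M} (hC : #C < κ) : ∃ c, RealizesAverage L U C c := by
  obtain ⟨c, hc⟩ := hM.exists_mem_of_definable hα hC {D | C.Definable L D ∧ D ∈ U}
    (fun D hD => hD.1) ⟨Set.definable_univ, Filter.univ_mem⟩
    (fun D hD D' hD' => ⟨hD.1.inter hD'.1, Filter.inter_mem hD.2 hD'.2⟩)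
    (fun D hD => Filter.nonempty_of_mem hD.2)
  exact ⟨c, fun D hD hDU => hc D ⟨hD, hDU⟩⟩

/-- If `U` concentrates on tuples from `N`, its average type is `N`-invariant. -/
theorem RealizesAverage.sameType_sum {α : Type*} {U : Ultrafilter (α → M)} {N : Set M}
    (hU : {u : α → M | ∀ i, u i ∈ N} ∈ U) {a a' c c' : α → M}
    (ha : RealizesAverage L U N a) (ha' : RealizesAverage L U N a')
    (hc : RealizesAverage L U (N ∪ Set.range a) c)
    (hc' : RealizesAverage L U (N ∪ Set.range a') c') :
    SameType L N (Sum.elim a c) (Sum.elim a' c') := by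
  refine .of_imp fun D hD hac => ?_
  have h1 : {w | Sum.elim a w ∈ D} ∈ U := (hc.mem_iff (hD.fiber a)).1 hac
  refine (hc'.mem_iff (hD.fiber a')).2 ?_
  -- For `u` with entries in `N`, the set of `x` with `(x, u) ∈ D` is `N`-definable, so `a` and `a'`
  -- lie in it together.
  filter_upwards [h1, hU] with u hu huN
  have h2 := (hD.preimage_comp Sum.swap).fiber u
  have h3 : N ∪ Set.range u = N := Set.union_eq_left.2 (by rintro _ ⟨i, rfl⟩; exact huN i)
  rw [h3] at h2
  have h4 : ∀ x : α → M, x ∈ {w | Sum.elim u w ∈ (fun g : α ⊕ α → M => g ∘ Sum.swap) ⁻¹' D} ↔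
      Sum.elim x u ∈ D := by
    intro x
    simp only [Set.mem_ofPred_eq, Set.mem_preimage]
    refine iff_of_eq (congrArg (· ∈ D) ?_)
    ext i
    cases i <;> rfl
  have h5 := (ha.mem_iff h2).trans (ha'.mem_iff h2).symm
  rw [h4, h4] at h5
  exact h5.1 hu

/-- Invariant equivalence relations with few classes are coarser than equality of types over
a small model. -/
theorem exists_small_sameType_imp_eq (hM : IsMonsterModel L κ M) {α : Type w} (hα : #α < κ)
    {B : Set M} (hB : #B < κ) :
    ∃ N : Set M, B ⊆ N ∧ #N < κ ∧ ∀ (Q : Type w) (f : (α → M) → Q), #Q < κ →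
      (∀ σ : M ≃[L] M, (∀ b ∈ B, σ b = b) → ∀ x y : α → M, f x = f y →
        f (fun i => σ (x i)) = f (fun i => σ (y i))) →
      ∀ a b : α → M, SameType L N a b → f a = f b := by
  classical
  have := hM.infinite
  obtain ⟨S, hBS, hS⟩ := hM.exists_small_elementarySubstructure hB
  refine ⟨S, hBS, hS, fun Q f hQ hf a b hab => ?_⟩
  let P : Set (α → M) := {u | ∀ i, u i ∈ (S : Set M)}
  -- An ultrafilter extending this filter contains every `S`-definable set around `a` and
  -- concentrates on tuples from `S`; its average type is a global coheir of the type of `a`.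
  let 𝓕 : Filter (α → M) :=
    ⨅ D : {D : Set (α → M) // (S : Set M).Definable L D ∧ a ∈ D}, Filter.principal (D.1 ∩ P)
  have hne : 𝓕.NeBot := by
    have : Nonempty {D : Set (α → M) // (S : Set M).Definable L D ∧ a ∈ D} :=
      ⟨⟨Set.univ, Set.definable_univ, trivial⟩⟩
    refine Filter.iInf_neBot_of_directed ?_ ?_
    · rintro ⟨D, hD, haD⟩ ⟨D', hD', haD'⟩
      refine ⟨⟨D ∩ D', hD.inter hD', haD, haD'⟩, ?_, ?_⟩
      · exact Filter.principal_mono.2 fun x hx => ⟨hx.1.1, hx.2⟩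
      · exact Filter.principal_mono.2 fun x hx => ⟨hx.1.2, hx.2⟩
    · rintro ⟨D, hD, haD⟩
      obtain ⟨u, hu, huP⟩ := S.exists_mem_of_definable hD ⟨a, haD⟩
      exact Filter.principal_neBot_iff.2 ⟨u, hu, huP⟩
  let U : Ultrafilter (α → M) := Ultrafilter.of 𝓕
  have hmem : ∀ D, (S : Set M).Definable L D → a ∈ D → D ∩ P ∈ U := fun D hD haD =>
    Ultrafilter.of_le 𝓕 (Filter.mem_iInf_of_mem ⟨D, hD, haD⟩ (Filter.mem_principal_self _))
  have hP : P ∈ U := Filter.mem_of_superset (hmem _ Set.definable_univ trivial)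
    Set.inter_subset_right
  have ha : RealizesAverage L U S a := fun D hD hDU => by_contra fun haD =>
    Ultrafilter.compl_mem_iff_notMem.1
      (Filter.mem_of_superset (hmem _ hD.compl haD) Set.inter_subset_left) hDU
  have hb : RealizesAverage L U S b := fun D hD hDU => (hab D hD).1 (ha D hD hDU)
  obtain ⟨c, hc⟩ := exists_realizesAverage hM hα U
    (hM.mk_union_range_lt (hM.mk_union_range_lt hS hα a) hα b)
  -- One realisation of the average type over `S` for each value of `f` attained on such
  -- realisations; the default `a` plays no role.
  let y : Q → α → M := fun q =>
    if h : ∃ x, RealizesAverage L U S x ∧ f x = q then h.choose else a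
  have hy : ∀ x, RealizesAverage L U S x → RealizesAverage L U S (y (f x)) ∧ f (y (f x)) = f x := by
    intro x hx
    have h : ∃ x', RealizesAverage L U S x' ∧ f x' = f x := ⟨x, hx, rfl⟩
    simp only [y, dif_pos h]
    exact h.choose_spec
  have hQα : #(Q × α) < κ := by
    rw [Cardinal.mk_prod, Cardinal.lift_id, Cardinal.lift_id]
    exact Cardinal.mul_lt_of_lt hM.uncountable.le hQ hα
  -- Since `Q` is small, `d` can be generic over all chosen representatives at once, in particular
  -- over the one sharing its own value of `f`.
  obtain ⟨d, hd⟩ := exists_realizesAverage hM hα U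
    (hM.mk_union_range_lt hS hQα fun p : Q × α => y p.1 p.2)
  obtain ⟨hd1, hd2⟩ := hy d (hd.mono Set.subset_union_left)
  have hd3 : RealizesAverage L U (S ∪ Set.range (y (f d))) d := hd.mono
    (Set.union_subset_union_right _ (by rintro _ ⟨i, rfl⟩; exact ⟨(f d, i), rfl⟩))
  -- The pairs `(y (f d), d)` and `(x, c)` have the same type over `S`, so the equality `f (y (f d))
  -- = f d` transfers along an automorphism.
  have key : ∀ x, RealizesAverage L U S x → RealizesAverage L U (S ∪ Set.range x) c →
      f x = f c := by
    intro x hx hxc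
    obtain ⟨σ, hσ, hσx⟩ := (RealizesAverage.sameType_sum hP hd1 hx hd3 hxc).exists_automorphism hM
      (hM.mk_sum_lt hα hα) hS
    have h := hf σ (fun m hm => hσ m (hBS hm)) _ _ hd2
    rw [show (fun i => σ (y (f d) i)) = x from funext fun i => hσx (.inl i),
      show (fun i => σ (d i)) = c from funext fun i => hσx (.inr i)] at h
    exact h
  rw [key a ha (hc.mono Set.subset_union_left), key b hb (hc.mono (Set.union_subset_union_left _
    Set.subset_union_left))]

end BoundedInvariant

/-! ### The Galois connection between witnessing subgroups and sets -/

section Witnesses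

variable {G : Type*} {X : Type*} [Group G] [MulAction G X] {E : Setoid X}

theorem IsWitnessPair.rel_smul {H : Subgroup G} {Xt : Set X} (h : IsWitnessPair E H Xt)
    {g : G} (hg : g ∈ H) {x : X} (hx : x ∈ Xt) : E x (g • x) :=
  (h _ _).2 ⟨1, g⁻¹, H.inv_mem hg, by simp, by simpa using hx⟩

theorem IsWitnessPair.exists_smul_eq {H : Subgroup G} {Xt : Set X} (h : IsWitnessPair E H Xt)
    {x y : X} (hxy : E x y) : ∃ g : G, g • x = y := by
  obtain ⟨g, k, -, hk, -⟩ := (h x y).1 hxy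
  refine ⟨g⁻¹ * k⁻¹ * g, ?_⟩
  rw [mul_smul, hk, mul_smul, inv_smul_smul, inv_smul_smul]

/-- `orbitalRel` is monotone in both arguments, so only its inclusion in `E` is at stake; invariance
allows checking this at `g • x`, where it is `hcompat`. -/
theorem IsWitnessPair.enlarge (hinv : IsInvariantSetoid G E) {H H' : Subgroup G} {Xt Xt' : Set X}
    (h : IsWitnessPair E H Xt) (hH : H ≤ H') (hX : Xt ⊆ Xt')
    (hcompat : ∀ g ∈ H', ∀ x ∈ Xt', E x (g • x)) : IsWitnessPair E H' Xt' := by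
  refine fun x y => ⟨fun hxy => ?_, ?_⟩
  · obtain ⟨g, k, hk, hgk, hg⟩ := (h x y).1 hxy
    exact ⟨g, k, hH hk, hgk, hX hg⟩
  · rintro ⟨g, k, hk, hgk, hg⟩
    have h1 := hcompat k⁻¹ (H'.inv_mem hk) _ hg
    rw [hgk, inv_smul_smul, ← hgk] at h1
    exact (hinv g x y).2 h1

/-- The group of elements which preserve the `E`-class of each point of `Xt`. -/
def classwiseStabilizer (hinv : IsInvariantSetoid G E) (Xt : Set X) : Subgroup G where
  carrier := {g | ∀ x ∈ Xt, E x (g • x)}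
  one_mem' x _ := by simp
  mul_mem' {a b} ha hb x hx := by
    rw [mul_smul]
    exact E.trans (ha x hx) ((hinv a _ _).1 (hb x hx))
  inv_mem' {a} ha x hx := by
    rw [hinv a, smul_inv_smul]
    exact E.symm (ha x hx)

theorem mem_classwiseStabilizer {hinv : IsInvariantSetoid G E} {Xt : Set X} {g : G} :
    g ∈ classwiseStabilizer hinv Xt ↔ ∀ x ∈ Xt, E x (g • x) := Iff.rfl

variable (E) in
/-- The points whose `E`-class is preserved by every element of `H`. -/
def stablePoints (H : Subgroup G) : Set X := {x | ∀ g ∈ H, E x (g • x)}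

theorem IsWitnessPair.classwiseStabilizer (hinv : IsInvariantSetoid G E) {H : Subgroup G}
    {Xt : Set X} (h : IsWitnessPair E H Xt) :
    IsWitnessPair E (classwiseStabilizer hinv Xt) Xt :=
  h.enlarge hinv (fun _ hg _ hx => h.rel_smul hg hx) subset_rfl fun _ hg x hx => hg x hx

theorem IsWitnessPair.stablePoints (hinv : IsInvariantSetoid G E) {H : Subgroup G}
    {Xt : Set X} (h : IsWitnessPair E H Xt) : IsWitnessPair E H (stablePoints E H) :=
  h.enlarge hinv le_rfl (fun _ hx _ hg => h.rel_smul hg hx) fun g hg _ hx => hx g hg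

theorem IsMaximalWitnessSubgroup.exists_eq (hinv : IsInvariantSetoid G E) {H : Subgroup G}
    (h : IsMaximalWitnessSubgroup E H) : ∃ Xt : Set X, H = _root_.classwiseStabilizer hinv Xt := by
  obtain ⟨Xt, hXt, hmax⟩ := h
  refine ⟨Xt, by_contra fun hne => hmax _ (lt_of_le_of_ne ?_ hne) (hXt.classwiseStabilizer hinv)⟩
  exact fun _ hg _ hx => hXt.rel_smul hg hx

theorem IsMaximalWitnessSet.exists_eq (hinv : IsInvariantSetoid G E) {Xt : Set X}
    (h : IsMaximalWitnessSet G E Xt) : ∃ H : Subgroup G, Xt = _root_.stablePoints E H := by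
  obtain ⟨H, hH, hmax⟩ := h
  refine ⟨H, by_contra fun hne => hmax _ (lt_of_le_of_ne ?_ hne) (hH.stablePoints hinv)⟩
  exact fun _ hx _ hg => hH.rel_smul hg hx

/-- Closing once on each side suffices: the final subgroup contains `H`, so a set compatible with it
is compatible with `H` and hence lies in the stable points of `H`. -/
theorem IsWeaklyOrbital.exists_maximal (hinv : IsInvariantSetoid G E) (h : IsWeaklyOrbital G E) :
    ∃ (H : Subgroup G) (Xt : Set X), IsMaximalWitnessSubgroup E H ∧ IsMaximalWitnessSet G E Xt ∧
      IsWitnessPair E H Xt := by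
  obtain ⟨H, Xt, hpair⟩ := h
  have h1 := hpair.stablePoints hinv
  have h2 := h1.classwiseStabilizer hinv
  refine ⟨_, _, ⟨_, h2, fun H' hlt hH' => ?_⟩, ⟨_, h2, fun Xt' hlt hXt' => ?_⟩, h2⟩
  · exact hlt.not_ge fun g hg x hx => hH'.rel_smul hg hx
  · exact hlt.not_ge fun x hx g hg => hXt'.rel_smul (fun _ hy => hy g hg) hx

end Witnesses

/-! ### Automorphisms of the structure acting on `G` and `X` -/

section TypeClosedActions

open FirstOrder FirstOrder.Language

variable {L : FirstOrder.Language.{u, v}} {M : Type w} [L.Structure M] {κ : Cardinal.{w}}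

theorem IsTypeClosed.isInvariantOver {α : Type w} {B : Set M} {S : Set (α → M)}
    (h : IsTypeClosed L B S) : IsInvariantOver L B S := by
  have key : ∀ σ : M ≃[L] M, (∀ b ∈ B, σ b = b) → ∀ v ∈ S, (fun i => σ (v i)) ∈ S :=
    fun σ hσ v hv => h _ fun D hD hSD => (hD.comp_mem_iff σ hσ v).2 (hSD hv)
  refine fun σ hσ v => ⟨fun hv => ?_, key σ hσ v⟩
  have := key σ.symm (fun b hb => by
    conv_lhs => rw [← hσ b hb]
    exact σ.symm_apply_apply b) _ hv
  simpa using this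

variable {I J : Type w} {G : Set (J → M)} {X : Set (I → M)}

theorem mem_image_val_iff {α : Type*} {Y : Set α} {S : Set Y} {v : α} :
    v ∈ (fun y : Y => (y : α)) '' S ↔ ∃ h : v ∈ Y, (⟨v, h⟩ : Y) ∈ S := by
  simp

variable [Group G] [MulAction G X]

variable (G X) in
/-- The graph of the action of `G` on `X`, as a set of tuples. -/
def smulGraph : Set (J ⊕ I ⊕ I → M) :=
  {v | ∃ (g : G) (x : X), v = Sum.elim g.1 (Sum.elim x.1 (g • x).1)}

variable (L G X) in
/-- All the data of the action of `G` on `X` are type-definable over `B`. -/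
structure IsTypeClosedAction (B : Set M) : Prop where
  group : IsTypeClosed L B G
  mul_graph : IsTypeClosed L B
    {v : J ⊕ J ⊕ J → M | ∃ a b : G, v = Sum.elim a.1 (Sum.elim b.1 (a * b).1)}
  space : IsTypeClosed L B X
  smul_graph : IsTypeClosed L B (smulGraph G X)

theorem IsTypeClosedAction.mono {B C : Set M} (h : IsTypeClosedAction L G X B) (hBC : B ⊆ C) :
    IsTypeClosedAction L G X C :=
  ⟨h.group.mono hBC, h.mul_graph.mono hBC, h.space.mono hBC, h.smul_graph.mono hBC⟩

theorem IsTypeDefinableAction.exists_isTypeClosedAction (hM : IsMonsterModel L κ M)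
    (hI : #I < κ) (hJ : #J < κ) (h : IsTypeDefinableAction L G X κ) {A : Set M} (hA : #A < κ) :
    ∃ B : Set M, #B < κ ∧ A ⊆ B ∧ IsTypeClosedAction L G X B := by
  have hII := hM.mk_sum_lt hI hI
  obtain ⟨B₁, hB₁, h₁⟩ := (isTypeDefinable_iff hM hJ).1 h.group
  obtain ⟨B₂, hB₂, h₂⟩ := (isTypeDefinable_iff hM (hM.mk_sum_lt hJ (hM.mk_sum_lt hJ hJ))).1
    h.mul_graph
  obtain ⟨B₃, hB₃, h₃⟩ := (isTypeDefinable_iff hM hI).1 h.space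
  obtain ⟨B₄, hB₄, h₄⟩ := (isTypeDefinable_iff hM (hM.mk_sum_lt hJ hII)).1 h.smul_graph
  refine ⟨A ∪ (B₁ ∪ B₂ ∪ (B₃ ∪ B₄)), hM.mk_union_lt hA (hM.mk_union_lt (hM.mk_union_lt hB₁ hB₂)
    (hM.mk_union_lt hB₃ hB₄)), Set.subset_union_left, h₁.mono ?_, h₂.mono ?_, h₃.mono ?_,
    h₄.mono ?_⟩ <;> intro x hx <;> simp [hx]

namespace IsTypeClosedAction

variable {B : Set M} (h : IsTypeClosedAction L G X B) (σ : M ≃[L] M) (hσ : ∀ b ∈ B, σ b = b)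

/-- The automorphism of `G` induced by an automorphism of the structure. -/
def autGroup : G →* G :=
  MonoidHom.mk' (fun g => ⟨fun i => σ (g.1 i), (h.group.isInvariantOver σ hσ g.1).2 g.2⟩)
    (fun a b => by
      obtain ⟨a', b', hab⟩ := (h.mul_graph.isInvariantOver σ hσ _).2 ⟨a, b, rfl⟩
      have ha : (⟨fun i => σ (a.1 i), (h.group.isInvariantOver σ hσ a.1).2 a.2⟩ : G) = a' :=
        Subtype.ext (funext fun i => congrFun hab (.inl i))
      have hb : (⟨fun i => σ (b.1 i), (h.group.isInvariantOver σ hσ b.1).2 b.2⟩ : G) = b' :=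
        Subtype.ext (funext fun i => congrFun hab (.inr (.inl i)))
      rw [ha, hb]
      exact Subtype.ext (funext fun i => congrFun hab (.inr (.inr i))))

/-- The permutation of `X` induced by an automorphism of the structure. -/
def autSpace (x : X) : X := ⟨fun i => σ (x.1 i), (h.space.isInvariantOver σ hσ x.1).2 x.2⟩

theorem autSpace_smul (g : G) (x : X) :
    h.autSpace σ hσ (g • x) = h.autGroup σ hσ g • h.autSpace σ hσ x := by
  obtain ⟨g', x', hgx⟩ := (h.smul_graph.isInvariantOver σ hσ _).2 ⟨g, x, rfl⟩
  have hg : h.autGroup σ hσ g = g' := Subtype.ext (funext fun i => congrFun hgx (.inl i))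
  have hx : h.autSpace σ hσ x = x' := Subtype.ext (funext fun i => congrFun hgx (.inr (.inl i)))
  rw [hg, hx]
  exact Subtype.ext (funext fun i => congrFun hgx (.inr (.inr i)))

theorem autGroup_mem_iff {H : Subgroup G}
    (hH : IsInvariantOver L B ((fun g : G => (g : J → M)) '' (H : Set G))) (g : G) :
    h.autGroup σ hσ g ∈ H ↔ g ∈ H := by
  have := hH σ hσ g.1
  rw [mem_image_val_iff, mem_image_val_iff] at this
  exact ⟨fun hg => (this.1 ⟨(h.autGroup σ hσ g).2, hg⟩).2, fun hg => (this.2 ⟨g.2, hg⟩).2⟩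

theorem isInvariantOver_image_iff {S : Set X} :
    IsInvariantOver L B ((fun x : X => (x : I → M)) '' S) ↔
      ∀ σ hσ x, h.autSpace σ hσ x ∈ S ↔ x ∈ S := by
  refine forall_congr' fun σ => forall_congr' fun hσ => ?_
  have hX := h.space.isInvariantOver σ hσ
  simp only [mem_image_val_iff]
  refine ⟨fun hS x => ?_, fun hS v => ?_⟩
  · exact ⟨fun hx => ((hS x.1).1 ⟨_, hx⟩).2, fun hx => ((hS x.1).2 ⟨x.2, hx⟩).2⟩
  · exact ⟨fun ⟨h1, h2⟩ => ⟨(hX v).1 h1, (hS ⟨v, (hX v).1 h1⟩).1 h2⟩,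
      fun ⟨h1, h2⟩ => ⟨(hX v).2 h1, (hS ⟨v, h1⟩).2 h2⟩⟩

end IsTypeClosedAction
end TypeClosedActions

/-! ### The connected component and its coset representatives -/

section ConnectedComponent

open FirstOrder FirstOrder.Language

variable {L : FirstOrder.Language.{u, v}} {M : Type w} [L.Structure M] {κ : Cardinal.{w}}
  {I J : Type w} {G : Set (J → M)} {X : Set (I → M)} [Group G] [MulAction G X] {A B C : Set M}

/-- More parameters leave more subgroups to intersect. This lets the hypothesis over `A` pass to a
larger set over which the action is type-definable. -/
theorem connectedComponent000_anti (hAB : A ⊆ B) :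
    connectedComponent000 L G κ B ≤ connectedComponent000 L G κ A :=
  sInf_le_sInf fun _ hH => ⟨fun σ hσ => hH.1 σ fun a ha => hσ a (hAB ha), hH.2⟩

theorem IsTypeClosedAction.autGroup_mem_connectedComponent000 (h : IsTypeClosedAction L G X B)
    (σ : M ≃[L] M) (hσ : ∀ b ∈ B, σ b = b) {g : G} (hg : g ∈ connectedComponent000 L G κ B) :
    h.autGroup σ hσ g ∈ connectedComponent000 L G κ B :=
  Subgroup.mem_sInf.2 fun H hH => (h.autGroup_mem_iff σ hσ hH.1 g).2 (Subgroup.mem_sInf.1 hg H hH)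

/-- The connected component has small index. -/
theorem IsTypeClosedAction.index_connectedComponent000_lt (hM : IsMonsterModel L κ M)
    (hJ : #J < κ) (hB : #B < κ) (h : IsTypeClosedAction L G X B) :
    #(G ⧸ connectedComponent000 L G κ B) < κ := by
  classical
  obtain ⟨N, hBN, hN, hsame⟩ := exists_small_sameType_imp_eq hM hJ hB
  have key : ∀ a b : G, SameType L N a.1 b.1 → a⁻¹ * b ∈ connectedComponent000 L G κ B := by
    intro a b hab
    refine Subgroup.mem_sInf.2 fun H hH => ?_
    -- The coset map, extended by `none` outside `G`; invariance of `G` and `H` makes its kernel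
    -- invariant over `B`.
    let f : (J → M) → Option (G ⧸ H) := fun x =>
      if hx : x ∈ G then some (QuotientGroup.mk ⟨x, hx⟩) else none
    have hfG : ∀ g : G, f g.1 = some (QuotientGroup.mk g) := fun g => dif_pos g.2
    have hf : ∀ g g' : G, f g.1 = f g'.1 ↔ g⁻¹ * g' ∈ H := fun g g' => by
      rw [hfG, hfG, Option.some_inj, QuotientGroup.eq]
    refine (hf a b).1 (hsame _ f ?_ ?_ a.1 b.1 hab)
    · rw [Cardinal.mk_option]
      exact hM.add_lt hH.2 (Cardinal.one_lt_aleph0.trans hM.uncountable)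
    · intro σ hσ x y hxy
      have hG := h.group.isInvariantOver σ hσ
      by_cases hx : x ∈ G <;> by_cases hy : y ∈ G
      · have h1 := (hf ⟨x, hx⟩ ⟨y, hy⟩).1 hxy
        rw [← h.autGroup_mem_iff σ hσ hH.1, map_mul, map_inv] at h1
        exact (hf _ _).2 h1
      · simp [f, hx, hy] at hxy
      · simp [f, hx, hy] at hxy
      · simp only [f, dif_neg (mt (hG x).1 hx), dif_neg (mt (hG y).1 hy)]
  -- A coset is determined by the type over `N` of its representative.
  let F : G ⧸ connectedComponent000 L G κ B → Set {D : Set (J → M) | N.Definable L D} :=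
    fun q => {D | q.out.1 ∈ D.1}
  have hF : Function.Injective F := by
    intro p q hpq
    rw [← QuotientGroup.out_eq' p, ← QuotientGroup.out_eq' q, QuotientGroup.eq]
    exact key _ _ fun D hD => Set.ext_iff.1 hpq ⟨D, hD⟩
  refine (Cardinal.mk_le_of_injective hF).trans_lt ?_
  rw [Cardinal.mk_set]
  exact hM.strongLimit.isStrongPrelimit (hM.mk_definable_lt hJ hN)

variable (L κ) in
/-- Every coset of the connected component over `B` has a representative with coordinates
in `C ⊇ B`. -/
structure ContainsCosetRepresentatives (G : Set (J → M)) [Group G] (B C : Set M) : Prop where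
  subset : B ⊆ C
  exists_rep : ∀ g : G, ∃ r : G, (∀ i, r.1 i ∈ C) ∧ r⁻¹ * g ∈ connectedComponent000 L G κ B

theorem IsTypeClosedAction.exists_containsCosetRepresentatives (hM : IsMonsterModel L κ M)
    (hJ : #J < κ) (hB : #B < κ) (h : IsTypeClosedAction L G X B) :
    ∃ C : Set M, #C < κ ∧ ContainsCosetRepresentatives L κ G B C := by
  have hidx := h.index_connectedComponent000_lt hM hJ hB
  have hcard : #((G ⧸ connectedComponent000 L G κ B) × J) < κ := by
    rw [Cardinal.mk_prod, Cardinal.lift_id, Cardinal.lift_id]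
    exact Cardinal.mul_lt_of_lt hM.uncountable.le hidx hJ
  refine ⟨B ∪ Set.range fun p : (G ⧸ connectedComponent000 L G κ B) × J => p.1.out.1 p.2,
    hM.mk_union_range_lt hB hcard _, Set.subset_union_left, fun g => ?_⟩
  refine ⟨(QuotientGroup.mk g : G ⧸ connectedComponent000 L G κ B).out,
    fun i => .inr ⟨(_, i), rfl⟩, ?_⟩
  rw [← QuotientGroup.eq]
  exact QuotientGroup.out_eq' _

theorem ContainsCosetRepresentatives.mono {D : Set M}
    (hC : ContainsCosetRepresentatives L κ G B C) (hCD : C ⊆ D) :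
    ContainsCosetRepresentatives L κ G B D :=
  ⟨hC.subset.trans hCD, fun g => (hC.exists_rep g).imp fun _ hr => ⟨fun i => hCD (hr.1 i), hr.2⟩⟩

/-- The automorphism fixes the representative `r` of the coset of `g` and preserves the component,
so it moves `g` within `r` times the component. -/
theorem ContainsCosetRepresentatives.inv_mul_autGroup_mem
    (hC : ContainsCosetRepresentatives L κ G B C) (h : IsTypeClosedAction L G X B)
    (σ : M ≃[L] M) (hσ : ∀ c ∈ C, σ c = c) (g : G) :
    g⁻¹ * h.autGroup σ (fun b hb => hσ b (hC.subset hb)) g ∈ connectedComponent000 L G κ B := by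
  obtain ⟨r, hrC, hr⟩ := hC.exists_rep g
  have hσr : h.autGroup σ (fun b hb => hσ b (hC.subset hb)) r = r :=
    Subtype.ext (funext fun i => hσ _ (hrC i))
  have h1 := h.autGroup_mem_connectedComponent000 σ (fun b hb => hσ b (hC.subset hb)) hr
  rw [map_mul, map_inv, hσr] at h1
  have h2 := Subgroup.mul_mem _ (Subgroup.inv_mem _ hr) h1
  simpa [mul_assoc] using h2

end ConnectedComponent

/-! ### Type-definability of witnesses, and of `E` from its witnesses -/

section TypeDefinableWitnesses

open FirstOrder FirstOrder.Language

variable {L : FirstOrder.Language.{u, v}} {M : Type w} [L.Structure M] {κ : Cardinal.{w}}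
  {I J : Type w} {G : Set (J → M)} {X : Set (I → M)} [Group G] [MulAction G X] {A B C D : Set M}
  {E : Setoid X}

theorem sum_elim_mem_smulGraph_iff {g : J → M} {x y : I → M} :
    Sum.elim g (Sum.elim x y) ∈ smulGraph G X ↔
      ∃ (hg : g ∈ G) (hx : x ∈ X), ((⟨g, hg⟩ : G) • (⟨x, hx⟩ : X)).1 = y := by
  constructor
  · rintro ⟨g', x', hgx⟩
    obtain ⟨rfl, h1⟩ := Sum.elim_eq_iff.1 hgx
    obtain ⟨rfl, rfl⟩ := Sum.elim_eq_iff.1 h1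
    exact ⟨g'.2, x'.2, rfl⟩
  · rintro ⟨hg, hx, rfl⟩
    exact ⟨⟨g, hg⟩, ⟨x, hx⟩, rfl⟩

/-- The stabilizer of a type-definable `E`-class is type-definable over a fixed small set. -/
theorem IsTypeClosedAction.stabilizer_of_class (hM : IsMonsterModel L κ M)
    (hI : #I < κ) (hJ : #J < κ) (h : IsTypeClosedAction L G X B) (hinv : IsInvariantSetoid G E)
    (hN : ∀ n ∈ connectedComponent000 L G κ B, ∀ x : X, E x (n • x))
    (hC : ContainsCosetRepresentatives L κ G B C) (hCκ : #C < κ) (x : X)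
    (hx : IsTypeDefinableSubset L κ {y : X | E x y}) :
    IsTypeClosed L C ((fun g : G => (g : J → M)) '' {g : G | E x (g • x)}) := by
  obtain ⟨D, hD, hclosed⟩ := (isTypeDefinable_iff hM hI).1 hx
  have hBκ : #B < κ := (Cardinal.mk_le_mk_of_subset hC.subset).trans_lt hCκ
  have hBDκ := hM.mk_union_lt hBκ hD
  -- The blocks of the graph are reordered to put the point first, so that `fiber` can fix it as a
  -- parameter.
  have h1 := (h.smul_graph.preimage_comp (β := I ⊕ (J ⊕ I))
    (Sum.elim (.inr ∘ .inl) (Sum.elim .inl (.inr ∘ .inr)))).fiber x.1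
  have h2 := hclosed.preimage_comp (β := J ⊕ I) .inr
  have h3 := (h1.mono (C := B ∪ D ∪ Set.range x.1) (Set.union_subset_union_left _
    Set.subset_union_left)).inter (h2.mono (Set.subset_union_of_subset_left
      Set.subset_union_right _))
  have h4 := h3.exists_sum hM hJ hI (hM.mk_union_range_lt hBDκ hI x.1)
  have h5 : ((fun g : G => (g : J → M)) '' {g : G | E x (g • x)}) =
      {v | ∃ w, Sum.elim v w ∈ {w | Sum.elim x.1 w ∈ {v | v ∘ Sum.elim (Sum.inr ∘ Sum.inl)
        (Sum.elim Sum.inl (Sum.inr ∘ Sum.inr)) ∈ smulGraph G X}} ∩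
        {v | v ∘ Sum.inr ∈ (fun y : X => (y : I → M)) '' {y | E x y}}} := by
    ext v
    have hcomp : ∀ w : I → M, Sum.elim x.1 (Sum.elim v w) ∘ Sum.elim (Sum.inr ∘ Sum.inl)
        (Sum.elim Sum.inl (Sum.inr ∘ Sum.inr)) = Sum.elim v (Sum.elim x.1 w) := by
      intro w
      ext i
      rcases i with i | i | i <;> rfl
    simp only [Set.mem_ofPred_eq, Set.mem_inter_iff, hcomp, sum_elim_mem_smulGraph_iff,
      Sum.elim_comp_inr, mem_image_val_iff]
    constructor
    · rintro ⟨hv, hE⟩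
      exact ⟨_, ⟨hv, x.2, rfl⟩, Subtype.prop _, hE⟩
    · rintro ⟨w, ⟨hv, _, rfl⟩, _, hE⟩
      exact ⟨hv, hE⟩
  rw [← h5] at h4
  -- The description found so far uses `x` and `D`. Invariance over `C` removes them, making the
  -- parameters the same for all `x`.
  refine h4.of_invariant hM hJ hCκ (hM.mk_union_range_lt hBDκ hI x.1) ?_
  intro σ hσ v
  have hσB : ∀ b ∈ B, σ b = b := fun b hb => hσ b (hC.subset hb)
  have key : ∀ g : G, E x (h.autGroup σ hσB g • x) ↔ E x (g • x) := by
    intro g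
    have h6 := hN _ (hC.inv_mul_autGroup_mem h σ hσ g) x
    rw [hinv g, smul_smul, mul_inv_cancel_left] at h6
    exact ⟨fun h7 => E.trans h7 (E.symm h6), fun h7 => E.trans h7 h6⟩
  simp only [mem_image_val_iff]
  have hG := h.group.isInvariantOver σ hσB v
  exact ⟨fun ⟨hv, h7⟩ => ⟨hG.1 hv, (key ⟨v, hG.1 hv⟩).1 h7⟩,
    fun ⟨hv, h7⟩ => ⟨hG.2 hv, (key ⟨v, hv⟩).2 h7⟩⟩

/-- `Xt` may be large: each condition is type-definable over the same `C`, so the size of the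
intersection is harmless. -/
theorem IsTypeClosedAction.classwiseStabilizer (hM : IsMonsterModel L κ M)
    (hI : #I < κ) (hJ : #J < κ) (h : IsTypeClosedAction L G X B) (hinv : IsInvariantSetoid G E)
    (hN : ∀ n ∈ connectedComponent000 L G κ B, ∀ x : X, E x (n • x))
    (hC : ContainsCosetRepresentatives L κ G B C) (hCκ : #C < κ)
    (hx : ∀ x : X, IsTypeDefinableSubset L κ {y : X | E x y}) (Xt : Set X) :
    IsTypeDefinableSubset L κ (classwiseStabilizer hinv Xt : Set G) := by
  have h1 := (h.group.mono hC.subset).inter (IsTypeClosed.iInter fun x : Xt =>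
    h.stabilizer_of_class hM hI hJ hinv hN hC hCκ x.1 (hx x))
  refine (isTypeDefinable_iff hM hJ).2 ⟨C, hCκ, ?_⟩
  convert h1 using 1
  ext v
  simp only [mem_image_val_iff, Set.mem_inter_iff, Set.mem_iInter, SetLike.mem_coe,
    mem_classwiseStabilizer, Set.mem_ofPred_eq]
  exact ⟨fun ⟨hv, h2⟩ => ⟨hv, fun x => ⟨hv, h2 x.1 x.2⟩⟩,
    fun ⟨hv, h2⟩ => ⟨hv, fun x hx => (h2 ⟨x, hx⟩).2⟩⟩

theorem sum_elim_mem_rel_iff {R : X → X → Prop} {x y : I → M} :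
    Sum.elim x y ∈ {v : I ⊕ I → M | ∃ x y : X, R x y ∧ v = Sum.elim x.1 y.1} ↔
      ∃ (hx : x ∈ X) (hy : y ∈ X), R ⟨x, hx⟩ ⟨y, hy⟩ := by
  constructor
  · rintro ⟨a, b, hab, h⟩
    obtain ⟨rfl, rfl⟩ := Sum.elim_eq_iff.1 h
    exact ⟨a.2, b.2, hab⟩
  · rintro ⟨hx, hy, hR⟩
    exact ⟨_, _, hR, rfl⟩

theorem IsTypeDefinableRel.class (hM : IsMonsterModel L κ M) (hI : #I < κ)
    (hE : IsTypeDefinableRel L κ E) (x : X) : IsTypeDefinableSubset L κ {y : X | E x y} := by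
  obtain ⟨B, hB, h⟩ := (isTypeDefinable_iff hM (hM.mk_sum_lt hI hI)).1 hE
  refine (isTypeDefinable_iff hM hI).2 ⟨_, hM.mk_union_range_lt hB hI x.1, ?_⟩
  convert h.fiber x.1 using 1
  ext v
  rw [mem_image_val_iff, Set.mem_ofPred_eq, sum_elim_mem_rel_iff]
  exact ⟨fun ⟨hv, h⟩ => ⟨x.2, hv, h⟩, fun ⟨_, hv, h⟩ => ⟨hv, h⟩⟩

theorem IsTypeClosedAction.stablePoints (hM : IsMonsterModel L κ M)
    (hI : #I < κ) (h : IsTypeClosedAction L G X B) (hinv : IsInvariantSetoid G E)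
    (hN : ∀ n ∈ connectedComponent000 L G κ B, ∀ x : X, E x (n • x))
    (hC : ContainsCosetRepresentatives L κ G B C) (hCκ : #C < κ)
    (hE : IsTypeDefinableRel L κ E) (H : Subgroup G) :
    IsTypeDefinableSubset L κ (stablePoints E H) := by
  obtain ⟨D, hD, hclosed⟩ := (isTypeDefinable_iff hM (hM.mk_sum_lt hI hI)).1 hE
  have hCD := hM.mk_union_lt hCκ hD
  have hstep : ∀ g : G, IsTypeClosed L (C ∪ D) ((fun x : X => (x : I → M)) ''
      {x : X | E x (g • x)}) := by
    intro g
    -- Replacing `g` by `r` does not change the condition, and `r` contributes no parameters outside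
    -- `C`.
    obtain ⟨r, hrC, hr⟩ := hC.exists_rep g
    have hrange : C ∪ D ∪ Set.range r.1 = C ∪ D := Set.union_eq_left.2 (by
      rintro _ ⟨i, rfl⟩
      exact .inl (hrC i))
    have h1 := (h.smul_graph.mono (hC.subset.trans Set.subset_union_left)).fiber (B := C ∪ D) r.1
    rw [hrange] at h1
    have h2 := (h1.inter (hclosed.mono Set.subset_union_right)).exists_sum hM hI hI hCD
    convert h2 using 1
    ext v
    simp only [mem_image_val_iff, Set.mem_ofPred_eq, Set.mem_inter_iff]
    have hrg : ∀ x : X, E x (g • x) ↔ E x (r • x) := by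
      intro x
      have h3 := hN _ hr x
      rw [hinv r, smul_smul, mul_inv_cancel_left] at h3
      exact ⟨fun h4 => E.trans h4 (E.symm h3), fun h4 => E.trans h4 h3⟩
    constructor
    · rintro ⟨hv, h3⟩
      exact ⟨_, sum_elim_mem_smulGraph_iff.2 ⟨r.2, hv, rfl⟩,
        sum_elim_mem_rel_iff.2 ⟨hv, Subtype.prop _, (hrg _).1 h3⟩⟩
    · rintro ⟨w, h3, h4⟩
      obtain ⟨_, hv, rfl⟩ := sum_elim_mem_smulGraph_iff.1 h3
      obtain ⟨_, _, h5⟩ := sum_elim_mem_rel_iff.1 h4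
      exact ⟨hv, (hrg _).2 h5⟩
  have h1 := (h.space.mono (hC.subset.trans Set.subset_union_left)).inter
    (IsTypeClosed.iInter fun g : H => hstep g)
  refine (isTypeDefinable_iff hM hI).2 ⟨C ∪ D, hCD, ?_⟩
  convert h1 using 1
  ext v
  simp only [mem_image_val_iff, Set.mem_inter_iff, Set.mem_iInter]
  exact ⟨fun ⟨hv, h2⟩ => ⟨hv, fun g => ⟨hv, h2 g.1 g.2⟩⟩,
    fun ⟨hv, h2⟩ => ⟨hv, fun g hg => (h2 ⟨g, hg⟩).2⟩⟩

/-- A relation with a type-definable witness pair is type-definable. -/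
theorem IsTypeClosedAction.rel_of_witnessPair (hM : IsMonsterModel L κ M)
    (hI : #I < κ) (hJ : #J < κ) (h : IsTypeClosedAction L G X B) (hB : #B < κ)
    {H : Subgroup G} {Xt : Set X} (hH : IsTypeDefinableSubset L κ (H : Set G))
    (hXt : IsTypeDefinableSubset L κ Xt) (hpair : IsWitnessPair E H Xt) :
    IsTypeDefinableRel L κ E := by
  obtain ⟨B₁, hB₁, h₁⟩ := (isTypeDefinable_iff hM hJ).1 hH
  obtain ⟨B₂, hB₂, h₂⟩ := (isTypeDefinable_iff hM hI).1 hXt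
  have hII := hM.mk_sum_lt hI hI
  have hJJII := hM.mk_sum_lt (hM.mk_sum_lt hJ hJ) hII
  have hC := hM.mk_union_lt hB (hM.mk_union_lt hB₁ hB₂)
  replace h := h.mono (C := B ∪ (B₁ ∪ B₂)) Set.subset_union_left
  replace h₁ := h₁.mono (C := B ∪ (B₁ ∪ B₂)) fun x hx => .inr (.inl hx)
  replace h₂ := h₂.mono (C := B ∪ (B₁ ∪ B₂)) fun x hx => .inr (.inr hx)
  -- Free blocks `x₁`, `x₂`; quantified blocks `g`, `k`, `y₁ = g • x₁`, `y₂ = g • x₂`, subject to `k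
  -- • y₂ = y₁`.
  let V := (I ⊕ I) ⊕ ((J ⊕ J) ⊕ (I ⊕ I))
  let x₁ : I → V := fun i => .inl (.inl i)
  let x₂ : I → V := fun i => .inl (.inr i)
  let g : J → V := fun i => .inr (.inl (.inl i))
  let k : J → V := fun i => .inr (.inl (.inr i))
  let y₁ : I → V := fun i => .inr (.inr (.inl i))
  let y₂ : I → V := fun i => .inr (.inr (.inr i))
  have h3 := (((((h.smul_graph.preimage_comp (β := V) (Sum.elim g (Sum.elim x₁ y₁))).inter
    (h.smul_graph.preimage_comp (β := V) (Sum.elim g (Sum.elim x₂ y₂)))).inter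
    (h.smul_graph.preimage_comp (β := V) (Sum.elim k (Sum.elim y₂ y₁)))).inter
    (h₁.preimage_comp (β := V) k)).inter (h₂.preimage_comp (β := V) y₁)).exists_sum
      hM hII hJJII hC
  refine (isTypeDefinable_iff hM hII).2 ⟨_, hC, ?_⟩
  convert h3 using 1
  ext v
  obtain ⟨a, b, rfl⟩ : ∃ a b : I → M, v = Sum.elim a b :=
    ⟨v ∘ .inl, v ∘ .inr, (Sum.elim_comp_inl_inr v).symm⟩
  rw [sum_elim_mem_rel_iff]
  simp only [Set.mem_ofPred_eq, Set.mem_inter_iff, Sum.comp_elim, and_assoc]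
  constructor
  · rintro ⟨ha, hb, hE⟩
    obtain ⟨g₀, k₀, hk₀, hgk, hg₀⟩ := (hpair _ _).1 hE
    refine ⟨Sum.elim (Sum.elim g₀.1 k₀.1) (Sum.elim (g₀ • (⟨a, ha⟩ : X)).1
      (g₀ • (⟨b, hb⟩ : X)).1), ?_, ?_, ?_, ?_, ?_⟩
    · exact sum_elim_mem_smulGraph_iff.2 ⟨g₀.2, ha, rfl⟩
    · exact sum_elim_mem_smulGraph_iff.2 ⟨g₀.2, hb, rfl⟩
    · exact sum_elim_mem_smulGraph_iff.2 ⟨k₀.2, (g₀ • (⟨b, hb⟩ : X)).2, congrArg Subtype.val hgk.symm⟩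
    · exact mem_image_val_iff.2 ⟨k₀.2, hk₀⟩
    · exact mem_image_val_iff.2 ⟨(g₀ • (⟨a, ha⟩ : X)).2, hg₀⟩
  · rintro ⟨w, hw1, hw2, hw3, hw4, hw5⟩
    obtain ⟨hg, ha, h1⟩ := sum_elim_mem_smulGraph_iff.1 hw1
    obtain ⟨hg', hb, h2⟩ := sum_elim_mem_smulGraph_iff.1 hw2
    obtain ⟨hk, hy, h3⟩ := sum_elim_mem_smulGraph_iff.1 hw3
    obtain ⟨hk', h4⟩ := mem_image_val_iff.1 hw4
    obtain ⟨hy', h5⟩ := mem_image_val_iff.1 hw5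
    have e1 : (⟨_, hg⟩ : G) • (⟨a, ha⟩ : X) = ⟨_, hy'⟩ := Subtype.ext h1
    have e2 : (⟨_, hg⟩ : G) • (⟨b, hb⟩ : X) = ⟨_, hy⟩ := Subtype.ext h2
    have e3 : (⟨_, hk⟩ : G) • (⟨_, hy⟩ : X) = ⟨_, hy'⟩ := Subtype.ext h3
    refine ⟨ha, hb, (hpair _ _).2 ⟨⟨_, hg⟩, ⟨_, hk⟩, h4, ?_, ?_⟩⟩
    · rw [e2, e3]
      exact e1
    · rw [← e1] at h5
      exact h5

end TypeDefinableWitnesses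

/-! ### Boundedness and the logic topology -/

section LogicTopology

open FirstOrder FirstOrder.Language

variable {L : FirstOrder.Language.{u, v}} {M : Type w} [L.Structure M] {κ : Cardinal.{w}}
  {I J : Type w} {G : Set (J → M)} {X : Set (I → M)} [Group G] [MulAction G X] {B C : Set M}
  {E : Setoid X}

/-- Disjoint type-definable sets are separated by a definable set. -/
theorem IsTypeClosed.exists_definable_separating (hM : IsMonsterModel L κ M) {α : Type w}
    (hα : #α < κ) (hB : #B < κ) {S T : Set (α → M)} (hS : IsTypeClosed L B S)
    (hT : IsTypeClosed L B T) (hdisj : Disjoint S T) :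
    ∃ D : Set (α → M), B.Definable L D ∧ S ⊆ D ∧ Disjoint D T := by
  by_contra! hcon
  obtain ⟨v, hv⟩ := hM.exists_mem_of_definable hα hB
    {F | ∃ D D', B.Definable L D ∧ S ⊆ D ∧ B.Definable L D' ∧ T ⊆ D' ∧ F = D ∩ D'}
    (by rintro _ ⟨D, D', hD, -, hD', -, rfl⟩; exact hD.inter hD')
    ⟨Set.univ, Set.univ, by simp⟩
    (by
      rintro _ ⟨D, D', hD, hSD, hD', hTD', rfl⟩ _ ⟨D₁, D₁', hD₁, hSD₁, hD₁', hTD₁', rfl⟩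
      exact ⟨D ∩ D₁, D' ∩ D₁', hD.inter hD₁, Set.subset_inter hSD hSD₁, hD'.inter hD₁',
        Set.subset_inter hTD' hTD₁', Set.inter_inter_inter_comm _ _ _ _⟩)
    (by
      rintro _ ⟨D, D', hD, hSD, hD', hTD', rfl⟩
      obtain ⟨x, hxD, hxT⟩ := Set.not_disjoint_iff.1 (hcon D hD hSD)
      exact ⟨x, hxD, hTD' hxT⟩)
  refine Set.disjoint_left.1 hdisj
    (hS v fun D hD hSD => (hv _ ⟨D, Set.univ, hD, hSD, Set.definable_univ, Set.subset_univ _, rfl⟩).1)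
    (hT v fun D hD hTD => (hv _ ⟨Set.univ, D, Set.definable_univ, Set.subset_univ _, hD, hTD, rfl⟩).2)

/-- `E` refines the orbit relation, and each orbit contains at most as many classes as the component
has cosets, because the class of `g • x` depends only on the coset of `g`. -/
theorem IsTypeClosedAction.mk_quotient_lt_iff (hM : IsMonsterModel L κ M) (hJ : #J < κ)
    (hB : #B < κ) (h : IsTypeClosedAction L G X B) (hinv : IsInvariantSetoid G E)
    (hE : IsWeaklyOrbital G E)
    (hN : ∀ n ∈ connectedComponent000 L G κ B, ∀ x : X, E x (n • x)) :
    #(Quotient E) < κ ↔ #(MulAction.orbitRel.Quotient G X) < κ := by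
  obtain ⟨H, Xt, hpair⟩ := hE
  constructor
  · refine fun hlt => (Cardinal.mk_le_of_surjective
      (f := Quotient.map' (s₁ := E) (s₂ := MulAction.orbitRel G X) id ?_) ?_).trans_lt hlt
    · intro x y hxy
      obtain ⟨g, rfl⟩ := hpair.exists_smul_eq hxy
      exact (MulAction.orbitRel G X).symm (MulAction.orbitRel_apply.2 ⟨g, rfl⟩)
    · intro q
      induction q using Quotient.inductionOn' with
      | h x => exact ⟨Quotient.mk E x, rfl⟩
  · intro hlt
    have hcard : #(MulAction.orbitRel.Quotient G X × (G ⧸ connectedComponent000 L G κ B)) < κ := by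
      rw [Cardinal.mk_prod, Cardinal.lift_id, Cardinal.lift_id]
      exact Cardinal.mul_lt_of_lt hM.uncountable.le hlt
        (h.index_connectedComponent000_lt hM hJ hB)
    refine (Cardinal.mk_le_of_surjective (f := fun p : MulAction.orbitRel.Quotient G X ×
      (G ⧸ connectedComponent000 L G κ B) =>
        Quotient.mk E (p.2.out • Quotient.out (s := MulAction.orbitRel G X) p.1)) ?_).trans_lt hcard
    intro q
    induction q using Quotient.inductionOn with
    | h x =>
      have h1 : (MulAction.orbitRel G X) x
          (Quotient.out (s := MulAction.orbitRel G X) (Quotient.mk _ x)) :=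
        (MulAction.orbitRel G X).symm (Quotient.mk_out (s := MulAction.orbitRel G X) x)
      obtain ⟨g, hg⟩ := MulAction.orbitRel_apply.1 h1
      refine ⟨(Quotient.mk (MulAction.orbitRel G X) x, QuotientGroup.mk g), ?_⟩
      have h2 : ((QuotientGroup.mk g : G ⧸ connectedComponent000 L G κ B).out)⁻¹ * g ∈
          connectedComponent000 L G κ B := by
        rw [← QuotientGroup.eq]
        exact QuotientGroup.out_eq' _
      have h3 := hN _ h2 (Quotient.out (s := MulAction.orbitRel G X) (Quotient.mk _ x))
      rw [hinv (QuotientGroup.mk g : G ⧸ connectedComponent000 L G κ B).out, smul_smul,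
        mul_inv_cancel_left] at h3
      refine Quotient.sound (E.trans h3 ?_)
      simp only at hg
      rw [hg]

/-- If `E` is bounded, all `E`-saturated sets are invariant over a fixed small set. -/
theorem IsTypeClosedAction.exists_isInvariantOver_preimage (hM : IsMonsterModel L κ M)
    (hI : #I < κ) (h : IsTypeClosedAction L G X B) (hinv : IsInvariantSetoid G E)
    (hE : IsWeaklyOrbital G E)
    (hN : ∀ n ∈ connectedComponent000 L G κ B, ∀ x : X, E x (n • x))
    (hC : ContainsCosetRepresentatives L κ G B C) (hCκ : #C < κ) (hlt : #(Quotient E) < κ) :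
    ∃ D : Set M, #D < κ ∧ B ⊆ D ∧ ∀ S : Set (Quotient E),
      IsInvariantOver L D ((fun x : X => (x : I → M)) '' (Quotient.mk E ⁻¹' S)) := by
  have hcard : #(Quotient E × I) < κ := by
    rw [Cardinal.mk_prod, Cardinal.lift_id, Cardinal.lift_id]
    exact Cardinal.mul_lt_of_lt hM.uncountable.le hlt hI
  obtain ⟨H, Xt, hpair⟩ := hE
  -- An automorphism over `D` fixes the representative of each class and moves the `g` carrying it
  -- to `x` within its coset, so it preserves the class of `x`.
  let D := C ∪ Set.range fun p : Quotient E × I => p.1.out.1 p.2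
  have hCD : C ⊆ D := Set.subset_union_left
  have hBD : B ⊆ D := hC.subset.trans hCD
  refine ⟨D, hM.mk_union_range_lt hCκ hcard _, hBD, fun S => ?_⟩
  rw [(h.mono hBD).isInvariantOver_image_iff]
  intro σ hσ x
  have hσB : ∀ b ∈ B, σ b = b := fun b hb => hσ b (hBD hb)
  have h1 : E (Quotient.mk E x).out x := Quotient.mk_out x
  have hfix : h.autSpace σ hσB (Quotient.mk E x).out = (Quotient.mk E x).out :=
    Subtype.ext (funext fun i => hσ _ (.inr ⟨(Quotient.mk E x, i), rfl⟩))
  obtain ⟨g, hg⟩ := hpair.exists_smul_eq h1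
  have h2 : h.autSpace σ hσB x = h.autGroup σ hσB g • (Quotient.mk E x).out := by
    conv_lhs => rw [← hg, h.autSpace_smul, hfix]
  have h3 := hN _ (hC.inv_mul_autGroup_mem h σ (fun c hc => hσ c (hCD hc)) g)
    (Quotient.mk E x).out
  rw [hinv g, smul_smul, mul_inv_cancel_left, hg, ← h2] at h3
  have h4 : Quotient.mk E (h.autSpace σ hσB x) = Quotient.mk E x := Quotient.sound (E.symm h3)
  change Quotient.mk E (h.autSpace σ hσB x) ∈ S ↔ _
  rw [h4]
  rfl

theorem isTypeDefinableSubset_saturation (hM : IsMonsterModel L κ M) (hI : #I < κ)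
    (hB : #B < κ) (hE : IsTypeClosed L B {v : I ⊕ I → M | ∃ x y : X, E x y ∧ v = Sum.elim x.1 y.1})
    {D : Set (I → M)} (hD : IsTypeClosed L B D) :
    IsTypeDefinableSubset L κ (Quotient.mk E ⁻¹' (Quotient.mk E '' {z : X | z.1 ∈ D})) := by
  refine (isTypeDefinable_iff hM hI).2 ⟨B, hB, ?_⟩
  convert (hE.inter (hD.preimage_comp .inr)).exists_sum hM hI hI hB using 1
  ext v
  rw [mem_image_val_iff]
  constructor
  · rintro ⟨hv, z, hz, hzv⟩
    exact ⟨z.1, sum_elim_mem_rel_iff.2 ⟨hv, z.2, E.symm (Quotient.exact hzv)⟩, hz⟩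
  · rintro ⟨w, hvw, hwD⟩
    obtain ⟨hv, hw, hE⟩ := sum_elim_mem_rel_iff.1 hvw
    exact ⟨hv, ⟨w, hw⟩, hwD, Quotient.sound (E.symm hE)⟩

theorem IsLogicTopology.t2Space (hM : IsMonsterModel L κ M) (hI : #I < κ)
    {τ : TopologicalSpace (Quotient E)} (hτ : IsLogicTopology L κ E τ)
    (hE : IsTypeDefinableRel L κ E) : @T2Space _ τ := by
  obtain ⟨B, hB, hEB⟩ := (isTypeDefinable_iff hM (hM.mk_sum_lt hI hI)).1 hE
  refine @T2Space.mk _ τ fun p q hpq => ?_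
  induction p using Quotient.inductionOn with
  | h x =>
  induction q using Quotient.inductionOn with
  | h y =>
  have hC := hM.mk_union_range_lt (hM.mk_union_range_lt hB hI x.1) hI y.1
  have hx : IsTypeClosed L (B ∪ Set.range x.1 ∪ Set.range y.1) _ :=
    (hEB.fiber x.1).mono Set.subset_union_left
  have hy : IsTypeClosed L (B ∪ Set.range x.1 ∪ Set.range y.1) _ :=
    (hEB.fiber y.1).mono (Set.union_subset_union_left _ Set.subset_union_left)
  obtain ⟨D, hD, hxD, hyD⟩ := hx.exists_definable_separating hM hI hC hy (by
    refine Set.disjoint_left.2 fun v hv hv' => ?_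
    obtain ⟨_, hvX, h1⟩ := sum_elim_mem_rel_iff.1 hv
    obtain ⟨_, _, h2⟩ := sum_elim_mem_rel_iff.1 hv'
    exact hpq (Quotient.sound (E.trans h1 (E.symm h2))))
  have hEC : IsTypeClosed L (B ∪ Set.range x.1 ∪ Set.range y.1) _ :=
    hEB.mono (Set.subset_union_left.trans Set.subset_union_left)
  -- The open neighbourhoods are the complements of the saturations of `Dᶜ` and `D`. They are
  -- disjoint since every point lies in `Dᶜ` or in `D`.
  have h1 := isTypeDefinableSubset_saturation hM hI hC hEC (.of_definable hD.compl)
  have h2 := isTypeDefinableSubset_saturation hM hI hC hEC (.of_definable hD)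
  refine ⟨_, _, ((hτ _).2 h1).isOpen_compl, ((hτ _).2 h2).isOpen_compl, ?_, ?_, ?_⟩
  · rintro ⟨z, hz, hzx⟩
    exact hz (hxD (sum_elim_mem_rel_iff.2 ⟨x.2, z.2, E.symm (Quotient.exact hzx)⟩))
  · rintro ⟨z, hz, hzy⟩
    exact Set.disjoint_left.1 hyD hz
      (sum_elim_mem_rel_iff.2 ⟨y.2, z.2, E.symm (Quotient.exact hzy)⟩)
  · refine Set.disjoint_left.2 fun q hq hq' => ?_
    induction q using Quotient.inductionOn with
    | h z =>
    by_cases hz : z.1 ∈ D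
    · exact hq' ⟨z, hz, rfl⟩
    · exact hq ⟨z, hz, rfl⟩

theorem image_val_preimage_sInter {F : Set (Set (Quotient E))} :
    (fun x : X => (x : I → M)) '' (Quotient.mk E ⁻¹' ⋂₀ F) =
      X ∩ ⋂ S : F, (fun x : X => (x : I → M)) '' (Quotient.mk E ⁻¹' S.1) := by
  ext v
  simp only [mem_image_val_iff, Set.mem_inter_iff, Set.mem_iInter, Set.mem_preimage,
    Set.mem_sInter]
  exact ⟨fun ⟨hv, h⟩ => ⟨hv, fun S => ⟨hv, h S.1 S.2⟩⟩,
    fun ⟨hv, h⟩ => ⟨hv, fun S hS => (h ⟨S, hS⟩).2⟩⟩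

/-- The logic topology, if type-definable saturated sets are type-definable over a fixed set. -/
theorem exists_isLogicTopology (hM : IsMonsterModel L κ M) (hI : #I < κ) (hB : #B < κ)
    (hX : IsTypeClosed L B X) (hS : ∀ S : Set (Quotient E),
      IsTypeDefinableSubset L κ (Quotient.mk E ⁻¹' S) →
        IsTypeClosed L B ((fun x : X => (x : I → M)) '' (Quotient.mk E ⁻¹' S))) :
    ∃ τ : TopologicalSpace (Quotient E), IsLogicTopology L κ E τ := by
  have hdef : ∀ S : Set (Quotient E),
      IsTypeClosed L B ((fun x : X => (x : I → M)) '' (Quotient.mk E ⁻¹' S)) →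
        IsTypeDefinableSubset L κ (Quotient.mk E ⁻¹' S) :=
    fun S h => (isTypeDefinable_iff hM hI).2 ⟨B, hB, h⟩
  refine ⟨TopologicalSpace.ofClosed
    {S | IsTypeDefinableSubset L κ (Quotient.mk E ⁻¹' S)} ?_ ?_ ?_, fun S => ?_⟩
  · refine hdef _ ?_
    simpa using IsTypeClosed.of_definable Set.definable_empty
  · refine fun F hF => hdef _ ?_
    rw [image_val_preimage_sInter]
    exact hX.inter (.iInter fun S => hS _ (hF S.2))
  · refine fun S hSd T hTd => hdef _ ?_
    rw [Set.preimage_union, Set.image_union]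
    exact (hS _ hSd).union (hS _ hTd)
  · rw [← @isOpen_compl_iff]
    change Sᶜᶜ ∈ _ ↔ _
    rw [compl_compl]
    rfl

theorem IsLogicTopology.isTypeDefinableRel (hM : IsMonsterModel L κ M) (hI : #I < κ)
    (hB : #B < κ) (hX : IsTypeClosed L B X) (hS : ∀ S : Set (Quotient E),
      IsTypeDefinableSubset L κ (Quotient.mk E ⁻¹' S) →
        IsTypeClosed L B ((fun x : X => (x : I → M)) '' (Quotient.mk E ⁻¹' S)))
    {τ : TopologicalSpace (Quotient E)} (hτ : IsLogicTopology L κ E τ) (hT2 : @T2Space _ τ) :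
    IsTypeDefinableRel L κ E := by
  have hS' : ∀ S : Set (Quotient E), @IsClosed _ τ S →
      IsTypeClosed L B ((fun x : X => (x : I → M)) '' (Quotient.mk E ⁻¹' S)) :=
    fun S h => hS S ((hτ S).1 h)
  -- Complements of separating open sets form a closed cover of `X/E`. Thus `E` is the intersection,
  -- over all covers by two closed sets, of the condition that `x` lies over the first or `y` over
  -- the second; all of these share the parameters `B`.
  have h1 := ((hX.preimage_comp (β := I ⊕ I) .inl).inter (hX.preimage_comp .inr)).inter
    (IsTypeClosed.iInter fun p : {p : Set (Quotient E) × Set (Quotient E) //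
      @IsClosed _ τ p.1 ∧ @IsClosed _ τ p.2 ∧ p.1 ∪ p.2 = Set.univ} =>
      ((hS' _ p.2.1).preimage_comp (β := I ⊕ I) .inl).union
        ((hS' _ p.2.2.1).preimage_comp .inr))
  refine (isTypeDefinable_iff hM (hM.mk_sum_lt hI hI)).2 ⟨B, hB, ?_⟩
  convert h1 using 1
  ext v
  obtain ⟨a, b, rfl⟩ : ∃ a b : I → M, v = Sum.elim a b :=
    ⟨v ∘ .inl, v ∘ .inr, (Sum.elim_comp_inl_inr v).symm⟩
  rw [sum_elim_mem_rel_iff]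
  simp only [Set.mem_inter_iff, Set.mem_iInter, Set.mem_ofPred_eq, Set.mem_union,
    mem_image_val_iff, Sum.elim_comp_inl, Sum.elim_comp_inr, Set.mem_preimage]
  constructor
  · rintro ⟨ha, hb, hab⟩
    refine ⟨⟨ha, hb⟩, fun p => ?_⟩
    have hq : Quotient.mk E ⟨a, ha⟩ = Quotient.mk E ⟨b, hb⟩ := Quotient.sound hab
    have hmem : Quotient.mk E ⟨a, ha⟩ ∈ p.1.1 ∪ p.1.2 := by rw [p.2.2.2]; trivial
    rcases hmem with h | h
    · exact .inl ⟨ha, h⟩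
    · exact .inr ⟨hb, hq ▸ h⟩
  · rintro ⟨⟨ha, hb⟩, h⟩
    refine ⟨ha, hb, by_contra fun hab => ?_⟩
    have hne : Quotient.mk E ⟨a, ha⟩ ≠ Quotient.mk E ⟨b, hb⟩ := fun h => hab (Quotient.exact h)
    obtain ⟨U, V, hU, hV, haU, hbV, hUV⟩ := hT2.t2 hne
    rcases h ⟨(Uᶜ, Vᶜ), hU.isClosed_compl, hV.isClosed_compl, by
      rw [← Set.compl_inter, hUV.inter_eq, Set.compl_empty]⟩ with ⟨_, h⟩ | ⟨_, h⟩
    · exact h haU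
    · exact h hbV

end LogicTopology

/-! ### The main theorem -/

theorem mainTheorem7 (L : FirstOrder.Language.{u, v}) (M : Type w) [L.Structure M]
    (κ : Cardinal.{w}) (hM : IsMonsterModel L κ M)
    (I J : Type w) (hI : #I < κ) (hJ : #J < κ)
    (G : Set (J → M)) (X : Set (I → M)) [Group G] [MulAction G X]
    (hGX : IsTypeDefinableAction L G X κ)
    (E : Setoid X) (hinv : IsInvariantSetoid G E) (hE : IsWeaklyOrbital G E)
    (A : Set M) (hA : #A < κ)
    (hcls : ∀ n ∈ connectedComponent000 L G κ A, ∀ x y : X, E x y → E x (n • y)) :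
    List.TFAE [
      IsTypeDefinableRel L κ E,
      (∀ x : X, IsTypeDefinableSubset L κ {y : X | E x y}) ∧
        ∃ (H : Subgroup G) (Xt : Set X), IsTypeDefinableSubset L κ Xt ∧ IsWitnessPair E H Xt,
      ∃ (H : Subgroup G) (Xt : Set X), IsTypeDefinableSubset L κ (H : Set G) ∧
        IsTypeDefinableSubset L κ Xt ∧ IsWitnessPair E H Xt,
      (∀ H : Subgroup G, IsMaximalWitnessSubgroup E H →
          IsTypeDefinableSubset L κ (H : Set G)) ∧
        ∀ Xt : Set X, IsMaximalWitnessSet G E Xt → IsTypeDefinableSubset L κ Xt] ∧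
    (#(Quotient E) < κ ↔ #(MulAction.orbitRel.Quotient G X) < κ) ∧
    (#(Quotient E) < κ → ∃ τ : TopologicalSpace (Quotient E),
      IsLogicTopology L κ E τ ∧ (IsTypeDefinableRel L κ E ↔ @T2Space _ τ)) := by
  obtain ⟨B, hB, hAB, h⟩ := hGX.exists_isTypeClosedAction hM hI hJ hA
  have hN : ∀ n ∈ connectedComponent000 L G κ B, ∀ x : X, E x (n • x) := fun n hn x =>
    hcls n (connectedComponent000_anti hAB hn) x x (E.refl x)
  obtain ⟨C, hCκ, hC⟩ := h.exists_containsCosetRepresentatives hM hJ hB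
  refine ⟨?_, h.mk_quotient_lt_iff hM hJ hB hinv hE hN, fun hlt => ?_⟩
  · tfae_have 1 → 4 := fun hrel => by
      refine ⟨fun H hH => ?_, fun Xt hXt => ?_⟩
      · obtain ⟨Xt, rfl⟩ := hH.exists_eq hinv
        exact h.classwiseStabilizer hM hI hJ hinv hN hC hCκ (hrel.class hM hI) Xt
      · obtain ⟨H, rfl⟩ := hXt.exists_eq hinv
        exact h.stablePoints hM hI hinv hN hC hCκ hrel H
    tfae_have 4 → 3 := fun h4 => by
      obtain ⟨H, Xt, hH, hXt, hpair⟩ := hE.exists_maximal hinv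
      exact ⟨H, Xt, h4.1 H hH, h4.2 Xt hXt, hpair⟩
    tfae_have 3 → 1 := fun ⟨H, Xt, hH, hXt, hpair⟩ =>
      h.rel_of_witnessPair hM hI hJ hB hH hXt hpair
    -- `H` itself is arbitrary; it is replaced by the full classwise stabilizer of `Xt`, which is
    -- type-definable because the classes are.
    tfae_have 2 → 3 := fun ⟨hclass, H, Xt, hXt, hpair⟩ =>
      ⟨_, Xt, h.classwiseStabilizer hM hI hJ hinv hN hC hCκ hclass Xt, hXt,
        hpair.classwiseStabilizer hinv⟩
    tfae_have 1 → 2 := fun hrel => by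
      obtain ⟨H, Xt, -, hXt, hpair⟩ := tfae_4_to_3 (tfae_1_to_4 hrel)
      exact ⟨hrel.class hM hI, H, Xt, hXt, hpair⟩
    tfae_finish
  · obtain ⟨D, hD, hBD, hDinv⟩ :=
      h.exists_isInvariantOver_preimage hM hI hinv hE hN hC hCκ hlt
    have hS : ∀ S : Set (Quotient E), IsTypeDefinableSubset L κ (Quotient.mk E ⁻¹' S) →
        IsTypeClosed L D ((fun x : X => (x : I → M)) '' (Quotient.mk E ⁻¹' S)) := by
      intro S hSd
      obtain ⟨D', hD', hclosed⟩ := (isTypeDefinable_iff hM hI).1 hSd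
      exact hclosed.of_invariant hM hI hD hD' (hDinv S)
    have hX := h.space.mono hBD
    obtain ⟨τ, hτ⟩ := exists_isLogicTopology hM hI hD hX hS
    exact ⟨τ, hτ, fun hrel => hτ.t2Space hM hI hrel,
      fun hT2 => hτ.isTypeDefinableRel hM hI hD hX hS hT2⟩
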